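/- Let $\pi=(\pi^{ij})$ be a smooth Poisson tensor on $M=\mathbb{R}^n$ (so $\{f,g\}=\pi^{ij}\partial_if\,\partial_jg$), let $H\in C^\infty(M)$ and $\epsilon\ge 0$. On $T^*M=\mathbb{R}^n\times\mathbb{R}^n$ with coordinates $(x^i,p_i)$, let $\overline V=-\pi^{ij}(x)p_i\,\partial_{x^j}$, let $\phi_\epsilon(y,p)=\frac1\epsilon\int_0^\epsilon y(s)\,ds$, where $(y(s),p)$ is the integral curve of $\overline V$ starting at $(y,p)$ (and $\phi_0(y,p)=y$), and let $\alpha_\epsilon:U\to M$ be the Karasev realization map: the smooth solution of \[ \phi_\epsilon(\alpha_\epsilon(x,p),p)=x,\qquad \alpha_\epsilon(x,0)=x, \] on an open neighbourhood $U$ of the zero section $0_M$ with $(x,p)\in U\Rightarrow(x,-p)\in U$. Let $c:\mathbb{R}\to\mathbb{R}$ satisfy $c(-h)=c(h)$ (equivalently, the additive normalization $\int_0^hc$ of the generating function is odd in $h$), and let $S_{\epsilon,h}(x)$ be a smooth function of $(h,x)$ on an open neighbourhood $W$ of $\{0\}\times M$ in $\mathbb{R}\times M$, with $(x,dS_{\epsilon,h}(x))\in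 U$, solving the Hamilton–Jacobi evolution equation \[ \partial_hS_{\epsilon,h}(x)=H\bigl(\alpha_\epsilon(x,dS_{\epsilon,h}(x))\bigr)+c(h),\qquad S_{\epsilon,0}=0 . \] Then $S_{\epsilon,h}$ is odd in $h$: 1. If $(-r,r)\times M\subset W$ and, for $|h|<r$, $S_{\epsilon,h}$ is the exact generating function, i.e. $\mathrm{graph}(dS_{\epsilon,h})$ is the image of $0_M$ under the time-$h$ Hamiltonian flow of $H\circ\alpha_\epsilon$ in $(U,\,dp_i\wedge dx^i)$ (taken at those points of $0_M$ where it is defined), then $S_{\epsilon,-h}=-S_{\epsilon,h}$ on $M$ for all $|h|<r$. 2. In any case there is an open set $W'\subset W$ containing $\{0\}\times M$ and invariant under $(h,x)\mapsto(-h,x)$ such that $S_{\epsilon,-h}(x)=-S_{\epsilon,h}(x)$ for all $(h,x)\in W'$. 3. In particular, the coefficients $S_{\epsilon,(l)}=\frac1{l!}\partial_h^lS_{\epsilon,h}|_{h=0}$ vanish for even $l$, so that for every $m$ the truncation $\hat S_{\epsilon,h}=\sum_{l=0}^mS_{\epsilon,(l)}h^l$ has only odd powers of $h$: $\hat S_{\epsilon,h}=\sum_{l\le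 m,\ l\ \mathrm{odd}}S_{\epsilon,(l)}h^l$. -/

import Mathlib

open Set
open scoped ContDiff Topology

noncomputable section

namespace Karasev

/-- The phase space `M = ℝⁿ`. A point of `T*M = ℝⁿ × ℝⁿ` is a pair `(x, p)`, where `p` lists the
canonical momentum coordinates `p i`. -/
abbrev Pt (n : ℕ) : Type := Fin n → ℝ

variable {n : ℕ}

/-- The partial derivative `∂f/∂xⁱ` at `x`. -/
def pderiv (i : Fin n) (f : Pt n → ℝ) (x : Pt n) : ℝ :=
  fderiv ℝ f x (Pi.single i 1)

/-- The coordinate expression `p i = ∂f/∂xⁱ` of the differential of `f` at `x`. -/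
def differential (f : Pt n → ℝ) (x : Pt n) : Pt n :=
  fun i => pderiv i f x

/-- The graph of the differential of `f`, as a subset of `T*M`. -/
def graphDifferential (f : Pt n → ℝ) : Set (Pt n × Pt n) :=
  {z | z.2 = differential f z.1}

/-- The bracket `{f, g} = πⁱʲ ∂ᵢf ∂ⱼg` of a bivector field with components `πⁱʲ = π(dxⁱ, dxʲ)`. -/
def bracket (π : Pt n → Matrix (Fin n) (Fin n) ℝ) (f g : Pt n → ℝ) (x : Pt n) : ℝ :=
  ∑ i, ∑ j, π x i j * pderiv i f x * pderiv j g x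

/-- Smooth Poisson tensors on `ℝⁿ`: the associated bracket on smooth functions is skew-symmetric
and satisfies the Jacobi identity (the Leibniz rule is automatic for a bivector field). -/
structure IsPoissonTensor (π : Pt n → Matrix (Fin n) (Fin n) ℝ) : Prop where
  smooth : ∀ i j, ContDiff ℝ ∞ fun x => π x i j
  skew : ∀ x i j, π x j i = -π x i j
  jacobi : ∀ f g k : Pt n → ℝ, ContDiff ℝ ∞ f → ContDiff ℝ ∞ g → ContDiff ℝ ∞ k → ∀ x,
    bracket π (bracket π f g) k x + bracket π (bracket π k f) g x
      + bracket π (bracket π g k) f x = 0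

/-- The flat Poisson spray `-πⁱʲ(x) pᵢ ∂/∂xʲ` on `T*M`; the momenta do not evolve. -/
def spray (π : Pt n → Matrix (Fin n) (Fin n) ℝ) (z : Pt n × Pt n) : Pt n × Pt n :=
  (fun j => -∑ i, π z.1 i j * z.2 i, 0)

/-- The average over `[0, ε]` of the `x`-component of a curve in `T*M`
(for `ε = 0`: its value at time `0`). -/
def xAverage (ε : ℝ) (γ : ℝ → Pt n × Pt n) : Pt n :=
  if ε = 0 then (γ 0).1 else ε⁻¹ • ∫ s in (0 : ℝ)..ε, (γ s).1

/-- `φ_ε(y, p) = x`, for the `x`-average map `φ_ε` of the flow of the flat Poisson spray: the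
integral curve of the spray that starts at `(y, p)` exists on `[0, ε]` and its `x`-component has
average `x`. -/
def SprayAverage (π : Pt n → Matrix (Fin n) (Fin n) ℝ) (ε : ℝ) (y p x : Pt n) : Prop :=
  ∃ γ : ℝ → Pt n × Pt n, γ 0 = (y, p) ∧ IsIntegralCurveOn γ (fun _ => spray π) (Icc 0 ε) ∧
    xAverage ε γ = x

/-- `α : U → M` is the Karasev realization map `α_ε` of `(ℝⁿ, ε π)` on the open neighbourhood `U`
of the zero section of `T*M`: the smooth solution of `φ_ε(α(x, p), p) = x` with `α(x, 0) = x`.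
The neighbourhood is symmetric, so that the dual map `β(x, p) = α(x, -p)` is defined on it too. -/
structure IsKarasevMap (π : Pt n → Matrix (Fin n) (Fin n) ℝ) (ε : ℝ) (U : Set (Pt n × Pt n))
    (α : Pt n × Pt n → Pt n) : Prop where
  isOpen : IsOpen U
  zero_mem : ∀ x, (x, 0) ∈ U
  neg_mem : ∀ x p, (x, p) ∈ U → (x, -p) ∈ U
  smooth : ContDiffOn ℝ ∞ α U
  map_zero : ∀ x, α (x, 0) = x
  implicit : ∀ x p, (x, p) ∈ U → SprayAverage π ε (α (x, p)) p x

/-- The Hamiltonian vector field `-∂G/∂pᵢ ∂/∂xⁱ + ∂G/∂xⁱ ∂/∂pᵢ` of `G` with respect to the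
symplectic form `dpᵢ ∧ dxⁱ`. -/
def hamiltonianField (G : Pt n × Pt n → ℝ) (z : Pt n × Pt n) : Pt n × Pt n :=
  (fun i => -fderiv ℝ G z (0, Pi.single i 1), fun i => fderiv ℝ G z (Pi.single i 1, 0))

/-- The image of the zero section under the time-`h` Hamiltonian flow of `G` inside `U`. -/
def flowOfZeroSection (U : Set (Pt n × Pt n)) (G : Pt n × Pt n → ℝ) (h : ℝ) :
    Set (Pt n × Pt n) :=
  {z | ∃ γ : ℝ → Pt n × Pt n, (γ 0).2 = 0 ∧ (∀ t ∈ uIcc 0 h, γ t ∈ U) ∧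
    IsIntegralCurveOn γ (fun _ => hamiltonianField G) (uIcc 0 h) ∧ γ h = z}

/-- `S h x`, for `(h, x)` in an open neighbourhood `W` of `{0} × M`, is a smooth solution of the
evolution equation `∂S/∂h (x) = G(x, dS_h(x)) + c(h)` with `S_0 = 0`. The values of `S` outside
of `W` play no role. -/
structure IsHJSolution (U : Set (Pt n × Pt n)) (G : Pt n × Pt n → ℝ) (c : ℝ → ℝ)
    (W : Set (ℝ × Pt n)) (S : ℝ → Pt n → ℝ) : Prop where
  isOpen : IsOpen W
  zero_mem : ∀ x, (0, x) ∈ W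
  smooth : ContDiffOn ℝ ∞ (fun q : ℝ × Pt n => S q.1 q.2) W
  initial : ∀ x, S 0 x = 0
  mem : ∀ h x, (h, x) ∈ W → (x, differential (S h) x) ∈ U
  eqn : ∀ h x, (h, x) ∈ W →
    HasDerivAt (fun t => S t x) (G (x, differential (S h) x) + c h) h

/-- The coefficient of `h ^ l` in the Taylor expansion of `S` around `h = 0`. -/
def coeff (S : ℝ → Pt n → ℝ) (l : ℕ) (x : Pt n) : ℝ :=
  iteratedDeriv l (fun t => S t x) 0 / (l.factorial : ℝ)

/-- The truncation of `S` up to order `m` in `h`. -/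
def truncation (S : ℝ → Pt n → ℝ) (m : ℕ) (h : ℝ) (x : Pt n) : ℝ :=
  ∑ l ∈ Finset.range (m + 1), coeff S l x * h ^ l

end Karasev

end

/-!
The dual map `β (x, p) = α (x, -p)` is the endpoint of the spray curve starting at `α (x, p)`, as
the reversed curve has the same average and the opposite momentum. Differentiating the average along
a curve and its dual, and pairing the linearized spray with its adjoint, shows that `H ∘ α` and
`H ∘ β` Poisson commute (the Jacobi identity enters through the invariance of `π` under the flow of
the spray). Hence `H ∘ α - H ∘ β` is conserved by the Hamiltonian flow of `H ∘ α`; it vanishes on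
the zero section, so it vanishes on the lifts `(x, dS_h(x))` that the flow reaches. There `-S_{-h}`
solves the same Hamilton–Jacobi equation as `S_h`, with the same initial value.

Uniqueness follows along characteristics when they are known to reach the whole graph. Without that
assumption both the vanishing of the defect on the lifts and the uniqueness are local, by Haar's
argument: a function `v` vanishing at time zero with `|∂_h v| ≤ L ‖∂_x v‖` vanishes on a cone.
-/

noncomputable section

namespace Karasev

open Filter Metric Matrix
open scoped NNReal

/-! ### Ordinary differential equations -/

section ODE

variable {E : Type*} [NormedAddCommGroup E] [NormedSpace ℝ E] {a b t : ℝ}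

theorem hasDerivWithinAt_Ici_of_Icc {f : ℝ → E} {f' : E} (h : HasDerivWithinAt f f' (Icc a b) t)
    (ht : t ∈ Ico a b) : HasDerivWithinAt f f' (Ici t) t :=
  h.mono_of_mem_nhdsWithin (mem_of_superset (Icc_mem_nhdsGE ht.2) (Icc_subset_Icc_left ht.1))

theorem exists_isIntegralCurveOn_of_lipschitzWith_of_norm_le [CompleteSpace E] {f : ℝ → E → E}
    {K L : ℝ≥0} (hab : a ≤ b) (hlip : ∀ t ∈ Icc a b, LipschitzWith K (f t))
    (hcont : ∀ x, ContinuousOn (f · x) (Icc a b)) (hbound : ∀ t ∈ Icc a b, ∀ x, ‖f t x‖ ≤ L)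
    (x₀ : E) : ∃ γ : ℝ → E, γ a = x₀ ∧ IsIntegralCurveOn γ f (Icc a b) := by
  have hPL : IsPicardLindelof f (⟨a, left_mem_Icc.2 hab⟩ : Icc a b) x₀ (L * (b - a).toNNReal) 0
      L K :=
    { lipschitzOnWith := fun t ht => (hlip t ht).lipschitzOnWith
      continuousOn := fun x _ => hcont x
      norm_le := fun t ht x _ => hbound t ht x
      mul_max_le := by simp [Real.coe_toNNReal _ (sub_nonneg.2 hab), hab] }
  exact hPL.exists_eq_forall_mem_Icc_hasDerivWithinAt₀

theorem gronwallBound_mul (c δ K η x : ℝ) :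
    gronwallBound (c * δ) K (c * η) x = c * gronwallBound δ K η x := by
  unfold gronwallBound
  split_ifs <;> ring

theorem norm_sub_le_mul_gronwallBound_of_approx_linear {A : ℝ → E →L[ℝ] E} {K δ : ℝ}
    (hA : ∀ t ∈ Icc a b, ‖A t‖ ≤ K) {ξ η η' : ℝ → E}
    (hξ : IsIntegralCurveOn ξ (fun t => A t) (Icc a b))
    (hη : ∀ t ∈ Icc a b, HasDerivWithinAt η (η' t) (Icc a b) t)
    (hη' : ∀ t ∈ Icc a b, ‖η' t - A t (η t)‖ ≤ δ) (ha : ‖η a - ξ a‖ ≤ δ) :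
    ∀ t ∈ Icc a b, ‖η t - ξ t‖ ≤ δ * gronwallBound 1 K 1 (b - a) := by
  intro t ht
  have hδ : 0 ≤ δ := (norm_nonneg _).trans ha
  have hK : 0 ≤ K := (norm_nonneg _).trans (hA t ht)
  have hdiff : ∀ s ∈ Icc a b,
      HasDerivWithinAt (fun s => η s - ξ s) (η' s - A s (ξ s)) (Icc a b) s :=
    fun s hs => (hη s hs).sub (hξ s hs)
  have hderiv : ∀ s ∈ Icc a b, ‖η' s - A s (ξ s)‖ ≤ K * ‖η s - ξ s‖ + δ := fun s hs =>
    calc ‖η' s - A s (ξ s)‖ = ‖A s (η s - ξ s) + (η' s - A s (η s))‖ := by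
          rw [map_sub]; abel_nf
      _ ≤ ‖A s (η s - ξ s)‖ + ‖η' s - A s (η s)‖ := norm_add_le _ _
      _ ≤ K * ‖η s - ξ s‖ + δ :=
        add_le_add ((A s).le_of_opNorm_le (hA s hs) _) (hη' s hs)
  calc ‖η t - ξ t‖ ≤ gronwallBound δ K δ (t - a) :=
        norm_le_gronwallBound_of_norm_deriv_right_le
          (fun s hs => (hdiff s hs).continuousWithinAt)
          (fun s hs => hasDerivWithinAt_Ici_of_Icc (hdiff s (Ico_subset_Icc_self hs)) hs) ha
          (fun s hs => hderiv s (Ico_subset_Icc_self hs)) t ht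
    _ ≤ gronwallBound δ K δ (b - a) := gronwallBound_mono hδ hδ hK (by linarith [ht.2])
    _ = δ * gronwallBound 1 K 1 (b - a) := by simpa using gronwallBound_mul δ 1 K 1 (b - a)

theorem eqOn_of_isIntegralCurveOn_affine {A : ℝ → E →L[ℝ] E} {g : ℝ → E}
    (hA : ContinuousOn A (Icc a b)) {ξ η : ℝ → E}
    (hξ : IsIntegralCurveOn ξ (fun s x => A s x + g s) (Icc a b))
    (hη : IsIntegralCurveOn η (fun s x => A s x + g s) (Icc a b)) (ha : ξ a = η a) :
    EqOn ξ η (Icc a b) := by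
  obtain ⟨K, hK⟩ := isCompact_Icc.exists_bound_of_continuousOn hA
  have hlip : ∀ t ∈ Ico a b, LipschitzOnWith K.toNNReal (fun x => A t x + g t) univ :=
    fun t ht => by
      have hAK : ‖A t‖₊ ≤ K.toNNReal :=
        NNReal.le_toNNReal_of_coe_le (hK t (Ico_subset_Icc_self ht))
      simpa using (((A t).lipschitz.weaken hAK).add (LipschitzWith.const (g t)))
  exact ODE_solution_unique_of_mem_Icc_right hlip hξ.continuousOn
    (fun t ht => hasDerivWithinAt_Ici_of_Icc (hξ t (Ico_subset_Icc_self ht)) ht)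
    (fun _ _ => mem_univ _) hη.continuousOn
    (fun t ht => hasDerivWithinAt_Ici_of_Icc (hη t (Ico_subset_Icc_self ht)) ht)
    (fun _ _ => mem_univ _) ha

theorem exists_forall_norm_sub_sub_fderiv_le {F : Type*} [NormedAddCommGroup F] [NormedSpace ℝ F]
    {v : E → F} (hv : ContDiff ℝ 1 v) {k : Set E} (hk : IsCompact k) {e : ℝ} (he : 0 < e) :
    ∃ r > 0, ∀ x ∈ k, ∀ y ∈ ball x r, ‖v y - v x - fderiv ℝ v x (y - x)‖ ≤ e * ‖y - x‖ := by
  obtain ⟨r, hr, hclose⟩ := Metric.mem_uniformity_dist.1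
    (hk.uniformContinuousAt_of_continuousAt (fderiv ℝ v)
      (fun _ _ => (hv.continuous_fderiv one_ne_zero).continuousAt) (dist_mem_uniformity he))
  refine ⟨r, hr, fun x hx y hy => ?_⟩
  refine (convex_ball x r).norm_image_sub_le_of_norm_fderiv_le'
    (fun z _ => hv.differentiable one_ne_zero z) (fun z hz => ?_) (mem_ball_self hr) hy
  rw [← dist_eq_norm, dist_comm]
  exact (hclose (mem_ball'.1 hz) hx).le

theorem eqOn_zero_of_eventually_norm_deriv_le {f f' : ℝ → E}
    (hf : ∀ t ∈ Icc a b, HasDerivWithinAt f (f' t) (Icc a b) t) (ha : f a = 0)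
    (h : ∀ t ∈ Ico a b, f t = 0 → ∃ K : ℝ, ∀ᶠ s in 𝓝[Icc a b] t, ‖f' s‖ ≤ K * ‖f s‖) :
    EqOn f 0 (Icc a b) := by
  have hfc : ContinuousOn f (Icc a b) := fun t ht => (hf t ht).continuousWithinAt
  have hclosed : IsClosed ({t | f t = 0} ∩ Icc a b) := by
    rw [inter_comm]
    exact hfc.preimage_isClosed_of_isClosed isClosed_Icc isClosed_singleton
  refine hclosed.Icc_subset_of_forall_mem_nhdsWithin ha fun t ⟨hft, ht⟩ => ?_
  obtain ⟨K, hK⟩ := h t ht hft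
  have hle : 𝓝[≥] t ≤ 𝓝[Icc a b] t := le_inf nhdsWithin_le_nhds <| le_principal_iff.2 <|
    mem_of_superset (Icc_mem_nhdsGE ht.2) (Icc_subset_Icc_left ht.1)
  obtain ⟨u, hu, hsub⟩ := mem_nhdsGE_iff_exists_Icc_subset.1
    ((hK.and eventually_mem_nhdsWithin).filter_mono hle)
  have hIcc : Icc t u ⊆ Icc a b := fun s hs => (hsub hs).2
  have hzero := eq_zero_of_abs_deriv_le_mul_abs_self_of_eq_zero_right (hfc.mono hIcc)
    (fun s hs => hasDerivWithinAt_Ici_of_Icc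
      ((hf s (hIcc (Ico_subset_Icc_self hs))).mono hIcc) hs)
    hft fun s hs => (hsub (Ico_subset_Icc_self hs)).1
  exact mem_of_superset (Icc_mem_nhdsGT hu) hzero

section FiniteDimensional

variable [FiniteDimensional ℝ E]

theorem exists_contDiff_hasCompactSupport_eqOn_closedBall {v : E → E} {k : ℕ∞}
    (hv : ContDiff ℝ k v) (R : ℝ) :
    ∃ w : E → E, ContDiff ℝ k w ∧ HasCompactSupport w ∧ EqOn w v (closedBall 0 R) ∧
      ∀ x, ‖w x‖ ≤ ‖v x‖ := by
  have := FiniteDimensional.proper ℝ E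
  let χ : ContDiffBump (0 : E) :=
    ⟨max R 1, max R 1 + 1, lt_max_of_lt_right one_pos, lt_add_one _⟩
  refine ⟨fun x => χ x • v x, χ.contDiff.smul hv, χ.hasCompactSupport.smul_right, fun x hx => ?_,
    fun x => ?_⟩
  · have hχ : χ x = 1 :=
      χ.one_of_mem_closedBall (closedBall_subset_closedBall (le_max_left R 1) hx)
    simp only [hχ, one_smul]
  · rw [norm_smul, Real.norm_of_nonneg χ.nonneg]
    exact mul_le_of_le_one_left (norm_nonneg _) χ.le_one

theorem exists_isIntegralCurveOn_of_lipschitzWith {f : ℝ → E → E} {K : ℝ≥0} (hab : a ≤ b)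
    (hlip : ∀ t ∈ Icc a b, LipschitzWith K (f t)) (hcont : ∀ x, ContinuousOn (f · x) (Icc a b))
    (x₀ : E) : ∃ γ : ℝ → E, γ a = x₀ ∧ IsIntegralCurveOn γ f (Icc a b) := by
  obtain ⟨M, hM⟩ := isCompact_Icc.exists_bound_of_continuousOn (hcont 0)
  have hM₀ : 0 ≤ M := (norm_nonneg _).trans (hM a (left_mem_Icc.2 hab))
  have hgrowth : ∀ t ∈ Icc a b, ∀ x, ‖f t x‖ ≤ K * ‖x‖ + M := fun t ht x => by
    have h := (hlip t ht).norm_sub_le x 0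
    rw [sub_zero] at h
    linarith [norm_le_norm_add_norm_sub (f t 0) (f t x), norm_sub_rev (f t 0) (f t x), hM t ht]
  -- Grönwall's a priori bound, which also holds for the truncated equation `ξ' = f t (w ξ)`
  let R := gronwallBound ‖x₀‖ K M (b - a)
  obtain ⟨w, hwC, hwsupp, hwR, hw⟩ :=
    exists_contDiff_hasCompactSupport_eqOn_closedBall (k := 1) (contDiff_id (E := E)) R
  obtain ⟨C, hC⟩ := hwC.lipschitzWith_of_hasCompactSupport hwsupp one_ne_zero
  obtain ⟨B, hB⟩ := hwsupp.exists_bound_of_continuous hwC.continuous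
  have hbound : ∀ t ∈ Icc a b, ∀ x, ‖f t (w x)‖ ≤ (K * B + M).toNNReal := fun t ht x =>
    calc ‖f t (w x)‖ ≤ K * ‖w x‖ + M := hgrowth t ht (w x)
      _ ≤ K * B + M := by gcongr; exact hB x
      _ ≤ (K * B + M).toNNReal := Real.le_coe_toNNReal _
  obtain ⟨γ, hγa, hγ⟩ := exists_isIntegralCurveOn_of_lipschitzWith_of_norm_le
    (f := fun t x => f t (w x)) (K := K * C) hab (fun t ht => (hlip t ht).comp hC)
    (fun x => hcont (w x)) hbound x₀
  have hγgrowth : ∀ t ∈ Icc a b, ‖f t (w (γ t))‖ ≤ K * ‖γ t‖ + M := fun t ht =>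
    (hgrowth t ht _).trans (by gcongr; exact hw (γ t))
  have hγR : ∀ t ∈ Icc a b, ‖γ t‖ ≤ R := fun t ht =>
    (norm_le_gronwallBound_of_norm_deriv_right_le hγ.continuousOn
      (fun s hs => hasDerivWithinAt_Ici_of_Icc (hγ s (Ico_subset_Icc_self hs)) hs)
      (congrArg norm hγa).le
      (fun s hs => hγgrowth s (Ico_subset_Icc_self hs)) t ht).trans
    (gronwallBound_mono (norm_nonneg _) hM₀ K.2 (by linarith [ht.2]))
  refine ⟨γ, hγa, fun t ht => ?_⟩
  exact (hγ t ht).congr_deriv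
    (congrArg (f t) (hwR (mem_closedBall_zero_iff.2 (hγR t ht))))

theorem exists_isIntegralCurveOn_affine {A : ℝ → E →L[ℝ] E} {g : ℝ → E} (hab : a ≤ b)
    (hA : ContinuousOn A (Icc a b)) (hg : ContinuousOn g (Icc a b)) (x₀ : E) :
    ∃ ξ : ℝ → E, ξ a = x₀ ∧ IsIntegralCurveOn ξ (fun s x => A s x + g s) (Icc a b) := by
  obtain ⟨K, hK⟩ := isCompact_Icc.exists_bound_of_continuousOn hA
  refine exists_isIntegralCurveOn_of_lipschitzWith (K := K.toNNReal) hab (fun t ht => ?_)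
    (fun x => (hA.clm_apply continuousOn_const).add hg) x₀
  have hAK : ‖A t‖₊ ≤ K.toNNReal := NNReal.le_toNNReal_of_coe_le (hK t ht)
  simpa using ((A t).lipschitz.weaken hAK).add (LipschitzWith.const (g t))

theorem exists_isIntegralCurveOn_affine_terminal {A : ℝ → E →L[ℝ] E} {g : ℝ → E} (hab : a ≤ b)
    (hA : ContinuousOn A (Icc a b)) (hg : ContinuousOn g (Icc a b)) (x₀ : E) :
    ∃ ξ : ℝ → E, ξ b = x₀ ∧ IsIntegralCurveOn ξ (fun s x => A s x + g s) (Icc a b) := by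
  have hmaps : MapsTo (fun s => a + b - s) (Icc a b) (Icc a b) := fun s hs =>
    ⟨by linarith [hs.2], by linarith [hs.1]⟩
  have hcont : ContinuousOn (fun s => a + b - s) (Icc a b) := by fun_prop
  obtain ⟨ξ, hξa, hξ⟩ := exists_isIntegralCurveOn_affine hab (hA.comp hcont hmaps).neg
    (hg.comp hcont hmaps).neg x₀
  refine ⟨fun s => ξ (a + b - s), by simpa using hξa, fun s hs => ?_⟩
  refine ((hξ _ (hmaps hs)).scomp s ((hasDerivAt_id s).const_sub (a + b)).hasDerivWithinAt
    hmaps).congr_deriv ?_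
  simp [add_comm]

theorem eqOn_of_isIntegralCurveOn {v : E → E} (hv : ContDiff ℝ 1 v) {γ₁ γ₂ : ℝ → E}
    (h₁ : IsIntegralCurveOn γ₁ (fun _ => v) (Icc a b))
    (h₂ : IsIntegralCurveOn γ₂ (fun _ => v) (Icc a b)) (ha : γ₁ a = γ₂ a) :
    EqOn γ₁ γ₂ (Icc a b) := by
  obtain ⟨R₁, hR₁⟩ := isCompact_Icc.exists_bound_of_continuousOn h₁.continuousOn
  obtain ⟨R₂, hR₂⟩ := isCompact_Icc.exists_bound_of_continuousOn h₂.continuousOn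
  have := FiniteDimensional.proper ℝ E
  obtain ⟨K, hK⟩ := (hv.contDiffOn (s := closedBall 0 (max R₁ R₂))).exists_lipschitzOnWith
    one_ne_zero (convex_closedBall _ _) (isCompact_closedBall _ _)
  refine ODE_solution_unique_of_mem_Icc_right (fun _ _ => hK) h₁.continuousOn
    (fun t ht => hasDerivWithinAt_Ici_of_Icc (h₁ t (Ico_subset_Icc_self ht)) ht)
    (fun t ht => ?_) h₂.continuousOn
    (fun t ht => hasDerivWithinAt_Ici_of_Icc (h₂ t (Ico_subset_Icc_self ht)) ht)
    (fun t ht => ?_) ha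
  · exact mem_closedBall_zero_iff.2 ((hR₁ t (Ico_subset_Icc_self ht)).trans (le_max_left _ _))
  · exact mem_closedBall_zero_iff.2 ((hR₂ t (Ico_subset_Icc_self ht)).trans (le_max_right _ _))

theorem exists_eventually_dist_isIntegralCurveOn_le {v : E → E} (hv : ContDiff ℝ 1 v)
    {γ₀ : ℝ → E} (hγ₀ : IsIntegralCurveOn γ₀ (fun _ => v) (Icc a b)) :
    ∃ C : ℝ≥0, ∀ᶠ x in 𝓝 (γ₀ a), ∀ γ : ℝ → E, γ a = x →
      IsIntegralCurveOn γ (fun _ => v) (Icc a b) →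
        ∀ t ∈ Icc a b, dist (γ t) (γ₀ t) ≤ C * dist x (γ₀ a) := by
  obtain ⟨R, hR⟩ := isCompact_Icc.exists_bound_of_continuousOn hγ₀.continuousOn
  obtain ⟨w, hwC, hwsupp, hwv, -⟩ :=
    exists_contDiff_hasCompactSupport_eqOn_closedBall (k := 1) hv (R + 1)
  obtain ⟨K, hK⟩ := hwC.lipschitzWith_of_hasCompactSupport hwsupp one_ne_zero
  have hγ₀w : IsIntegralCurveOn γ₀ (fun _ => w) (Icc a b) := fun t ht =>
    (hγ₀ t ht).congr_deriv (hwv (mem_closedBall_zero_iff.2 (by linarith [hR t ht]))).symm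
  let C : ℝ≥0 := ⟨Real.exp (K * (b - a)), (Real.exp_pos _).le⟩
  have hnear : ∀ᶠ x in 𝓝 (γ₀ a), C * dist x (γ₀ a) < 1 := by
    have h : Tendsto (fun x => C * dist x (γ₀ a)) (𝓝 (γ₀ a)) (𝓝 (C * dist (γ₀ a) (γ₀ a))) :=
      Continuous.tendsto (by fun_prop) _
    exact h.eventually_lt_const (by simp)
  refine ⟨C, hnear.mono fun x hx γ hγa hγ t ht => ?_⟩
  have hab : a ≤ b := ht.1.trans ht.2
  -- the trajectory of the truncated field stays close to `γ₀`, hence is one of `v`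
  obtain ⟨η, hηa, hη⟩ := exists_isIntegralCurveOn_of_lipschitzWith hab (f := fun _ => w)
    (fun _ _ => hK) (fun _ => continuousOn_const) x
  have hdist : ∀ s ∈ Icc a b, dist (η s) (γ₀ s) ≤ C * dist x (γ₀ a) := fun s hs => by
    refine (dist_le_of_trajectories_ODE (fun _ => hK) hη.continuousOn
      (fun s hs => hasDerivWithinAt_Ici_of_Icc (hη s (Ico_subset_Icc_self hs)) hs)
      hγ₀w.continuousOn
      (fun s hs => hasDerivWithinAt_Ici_of_Icc (hγ₀w s (Ico_subset_Icc_self hs)) hs)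
      (by rw [hηa]) s hs).trans ?_
    rw [mul_comm]
    refine mul_le_mul_of_nonneg_right (Real.exp_le_exp.2 ?_) dist_nonneg
    gcongr
    exact hs.2
  have hηv : IsIntegralCurveOn η (fun _ => v) (Icc a b) := fun s hs => by
    refine (hη s hs).congr_deriv (hwv (mem_closedBall_zero_iff.2 ?_))
    have := norm_le_norm_add_norm_sub (γ₀ s) (η s)
    rw [← dist_eq_norm, dist_comm] at this
    linarith [hR s hs, hdist s hs]
  rw [eqOn_of_isIntegralCurveOn hv hγ hηv (hγa.trans hηa.symm) ht]
  exact hdist t ht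

theorem eventually_norm_slope_sub_fderiv_slope_le {v : E → E} (hv : ContDiff ℝ 1 v)
    {γ : ℝ → ℝ → E} {ξ₀ : E}
    (hγ : ∀ᶠ τ in 𝓝 0, IsIntegralCurveOn (γ τ) (fun _ => v) (Icc a b))
    (hinit : HasDerivAt (fun τ => γ τ a) ξ₀ 0) {δ : ℝ} (hδ : 0 < δ) :
    ∀ᶠ τ in 𝓝[≠] 0, ∀ s ∈ Icc a b,
      ‖slope (fun τ => v (γ τ s)) 0 τ - fderiv ℝ v (γ 0 s) (slope (fun τ => γ τ s) 0 τ)‖ ≤ δ := by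
  have hγ₀ := hγ.self_of_nhds
  obtain ⟨C, hC⟩ := exists_eventually_dist_isIntegralCurveOn_le hv hγ₀
  let B : ℝ := C * (‖ξ₀‖ + 1) + 1
  have hB : 0 < B := by positivity
  obtain ⟨r, hr, htaylor⟩ := exists_forall_norm_sub_sub_fderiv_le hv
    (isCompact_Icc.image_of_continuousOn hγ₀.continuousOn) (div_pos hδ hB)
  have hcurve : Tendsto (fun τ => γ τ a) (𝓝[≠] 0) (𝓝 (γ 0 a)) :=
    hinit.continuousAt.tendsto.mono_left nhdsWithin_le_nhds
  have hnear : ∀ᶠ τ in 𝓝[≠] 0, C * dist (γ τ a) (γ 0 a) < r :=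
    ((hcurve.dist (tendsto_const_nhds (x := γ 0 a))).const_mul (C : ℝ)).eventually_lt_const
      (by simpa using hr)
  filter_upwards [hγ.filter_mono nhdsWithin_le_nhds, hcurve.eventually hC, hnear,
    (hasDerivAt_iff_tendsto_slope.1 hinit).norm.eventually_le_const (lt_add_one _)]
    with τ hτ hdist hτr hslope s hs
  have hdist_s := hdist (γ τ) rfl hτ s hs
  calc ‖slope (fun τ => v (γ τ s)) 0 τ - fderiv ℝ v (γ 0 s) (slope (fun τ => γ τ s) 0 τ)‖
      = |τ|⁻¹ * ‖v (γ τ s) - v (γ 0 s) - fderiv ℝ v (γ 0 s) (γ τ s - γ 0 s)‖ := by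
        rw [slope_def_module, slope_def_module, sub_zero, map_smul, ← smul_sub, norm_smul,
          norm_inv, Real.norm_eq_abs]
    _ ≤ |τ|⁻¹ * (δ / B * (C * ‖γ τ a - γ 0 a‖)) := by
        gcongr
        refine (htaylor _ (mem_image_of_mem _ hs) _ (hdist_s.trans_lt hτr)).trans ?_
        rw [← dist_eq_norm, ← dist_eq_norm]
        gcongr
    _ = δ / B * (C * ‖slope (fun τ => γ τ a) 0 τ‖) := by
        rw [slope_def_module, sub_zero, norm_smul, norm_inv, Real.norm_eq_abs]
        ring
    _ ≤ δ / B * B := by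
        gcongr
        exact (mul_le_mul_of_nonneg_left hslope C.2).trans (le_add_of_nonneg_right zero_le_one)
    _ = δ := div_mul_cancel₀ _ hB.ne'

theorem tendstoUniformlyOn_slope_isIntegralCurveOn {v : E → E} (hv : ContDiff ℝ 1 v)
    {γ : ℝ → ℝ → E} {Ξ : ℝ → E}
    (hγ : ∀ᶠ τ in 𝓝 0, IsIntegralCurveOn (γ τ) (fun _ => v) (Icc a b))
    (hΞ : IsIntegralCurveOn Ξ (fun s => fderiv ℝ v (γ 0 s)) (Icc a b))
    (hinit : HasDerivAt (fun τ => γ τ a) (Ξ a) 0) :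
    TendstoUniformlyOn (fun τ s => slope (fun τ => γ τ s) 0 τ) Ξ (𝓝[≠] 0) (Icc a b) := by
  have hγ₀ := hγ.self_of_nhds
  obtain ⟨K, hK⟩ := isCompact_Icc.exists_bound_of_continuousOn
    ((hv.continuous_fderiv one_ne_zero).comp_continuousOn hγ₀.continuousOn)
  let G := gronwallBound 1 K 1 (b - a)
  rw [Metric.tendstoUniformlyOn_iff]
  intro e he
  obtain ⟨δ, hδ, hδG⟩ : ∃ δ > 0, δ * G < e := by
    have h : Tendsto (fun δ : ℝ => δ * G) (𝓝[>] 0) (𝓝 (0 * G)) :=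
      ((continuous_id.mul_const G).tendsto 0).mono_left nhdsWithin_le_nhds
    rw [zero_mul] at h
    exact (eventually_mem_nhdsWithin.and (h.eventually_lt_const he)).exists
  filter_upwards [hγ.filter_mono nhdsWithin_le_nhds,
    eventually_norm_slope_sub_fderiv_slope_le hv hγ hinit hδ,
    (tendsto_iff_norm_sub_tendsto_zero.1
      (hasDerivAt_iff_tendsto_slope.1 hinit)).eventually_le_const hδ] with τ hτ hdev hinitδ s hs
  have hslope_deriv : ∀ s ∈ Icc a b, HasDerivWithinAt (fun s => slope (fun τ => γ τ s) 0 τ)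
      (slope (fun τ => v (γ τ s)) 0 τ) (Icc a b) s := fun s hs => by
    simpa only [slope_def_module] using ((hτ s hs).fun_sub (hγ₀ s hs)).fun_const_smul _
  rw [dist_comm, dist_eq_norm]
  exact (norm_sub_le_mul_gronwallBound_of_approx_linear hK hΞ hslope_deriv hdev hinitδ s
    hs).trans_lt hδG

end FiniteDimensional

end ODE

/-! ### The linearized Poisson spray and Hamiltonian vector fields -/

section Poisson

variable {n : ℕ} {π : Pt n → Matrix (Fin n) (Fin n) ℝ}

theorem dotProduct_apply_single (L : Pt n →L[ℝ] ℝ) (v : Pt n) :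
    (fun i => L (Pi.single i 1)) ⬝ᵥ v = L v := by
  conv_rhs => rw [pi_eq_sum_univ' v]
  simp [dotProduct, mul_comm]

theorem differential_dotProduct (f : Pt n → ℝ) (x v : Pt n) :
    differential f x ⬝ᵥ v = fderiv ℝ f x v :=
  dotProduct_apply_single (fderiv ℝ f x) v

theorem hamiltonianField_pairing (G : Pt n × Pt n → ℝ) (z Y : Pt n × Pt n) :
    (hamiltonianField G z).2 ⬝ᵥ Y.1 - (hamiltonianField G z).1 ⬝ᵥ Y.2 = fderiv ℝ G z Y := by
  have h₁ := dotProduct_apply_single ((fderiv ℝ G z).comp (.inl ℝ (Pt n) (Pt n))) Y.1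
  have h₂ := dotProduct_apply_single ((fderiv ℝ G z).comp (.inr ℝ (Pt n) (Pt n))) Y.2
  simp only [ContinuousLinearMap.comp_apply, ContinuousLinearMap.inl_apply,
    ContinuousLinearMap.inr_apply] at h₁ h₂
  calc (hamiltonianField G z).2 ⬝ᵥ Y.1 - (hamiltonianField G z).1 ⬝ᵥ Y.2
      = fderiv ℝ G z (Y.1, 0) + fderiv ℝ G z (0, Y.2) := by
        rw [← h₁, ← h₂, ← sub_neg_eq_add, ← neg_dotProduct]; rfl
    _ = fderiv ℝ G z Y := by rw [← map_add]; simp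

theorem fderiv_hamiltonianField_self (G : Pt n × Pt n → ℝ) (z : Pt n × Pt n) :
    fderiv ℝ G z (hamiltonianField G z) = 0 := by
  rw [← hamiltonianField_pairing, dotProduct_comm, sub_self]

/-- The Jacobian matrix at `x` of the velocity `x ↦ π(x) p` of the Poisson spray with momentum
`p`. -/
def linearization (π : Pt n → Matrix (Fin n) (Fin n) ℝ) (p x : Pt n) : Matrix (Fin n) (Fin n) ℝ :=
  LinearMap.toMatrix' (fderiv ℝ (fun x => π x *ᵥ p) x : Pt n →ₗ[ℝ] Pt n)

theorem linearization_mulVec (p x v : Pt n) :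
    linearization π p x *ᵥ v = fderiv ℝ (fun x => π x *ᵥ p) x v := by
  rw [linearization, LinearMap.toMatrix'_mulVec]
  rfl

theorem IsPoissonTensor.dotProduct_mulVec (hπ : IsPoissonTensor π) (x v w : Pt n) :
    v ⬝ᵥ π x *ᵥ w = -(w ⬝ᵥ π x *ᵥ v) := by
  have htranspose : (π x)ᵀ = -π x := Matrix.ext fun i j => hπ.skew x i j
  rw [Matrix.dotProduct_mulVec, ← mulVec_transpose, htranspose, neg_mulVec, neg_dotProduct,
    dotProduct_comm]

theorem IsPoissonTensor.spray_eq (hπ : IsPoissonTensor π) (z : Pt n × Pt n) :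
    spray π z = (π z.1 *ᵥ z.2, 0) := by
  refine Prod.ext (funext fun j => ?_) rfl
  simp only [spray, mulVec, dotProduct, ← Finset.sum_neg_distrib]
  exact Finset.sum_congr rfl fun i _ => by rw [hπ.skew z.1 i j, neg_mul]

theorem IsPoissonTensor.contDiff_mulVec (hπ : IsPoissonTensor π) :
    ContDiff ℝ ∞ fun z : Pt n × Pt n => π z.1 *ᵥ z.2 :=
  contDiff_pi.2 fun i => by
    simp only [mulVec, dotProduct]
    exact ContDiff.sum fun j _ =>
      ((hπ.smooth i j).comp contDiff_fst).mul ((contDiff_apply ℝ ℝ j).comp contDiff_snd)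

theorem IsPoissonTensor.contDiff_mulVec_const (hπ : IsPoissonTensor π) (p : Pt n) :
    ContDiff ℝ ∞ fun x => π x *ᵥ p :=
  hπ.contDiff_mulVec.comp (contDiff_id.prodMk contDiff_const)

theorem IsPoissonTensor.contDiff_spray (hπ : IsPoissonTensor π) : ContDiff ℝ ∞ (spray π) := by
  rw [funext hπ.spray_eq]
  exact hπ.contDiff_mulVec.prodMk contDiff_const

theorem IsPoissonTensor.continuous_linearization (hπ : IsPoissonTensor π) (p : Pt n) :
    Continuous (linearization π p) :=
  ((LinearMap.toMatrix'.toLinearMap ∘ₗ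
    (ContinuousLinearMap.coeLM ℝ)).continuous_of_finiteDimensional).comp
      ((hπ.contDiff_mulVec_const p).continuous_fderiv (by simp))

theorem IsPoissonTensor.hasFDerivAt_dotProduct_mulVec (hπ : IsPoissonTensor π) (a b x : Pt n) :
    HasFDerivAt (fun x => a ⬝ᵥ π x *ᵥ b)
      ((dotProductBilin ℝ ℝ a).toContinuousLinearMap.comp (fderiv ℝ (fun x => π x *ᵥ b) x)) x :=
  (dotProductBilin ℝ ℝ a).toContinuousLinearMap.hasFDerivAt.comp x
    ((hπ.contDiff_mulVec_const b).differentiable (by simp) x).hasFDerivAt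

theorem IsPoissonTensor.fderiv_dotProduct_mulVec (hπ : IsPoissonTensor π) (a b x v : Pt n) :
    fderiv ℝ (fun x => a ⬝ᵥ π x *ᵥ b) x v = a ⬝ᵥ linearization π b x *ᵥ v := by
  rw [(hπ.hasFDerivAt_dotProduct_mulVec a b x).fderiv, linearization_mulVec]
  rfl

theorem IsPoissonTensor.dotProduct_linearization (hπ : IsPoissonTensor π) (a b x v : Pt n) :
    a ⬝ᵥ linearization π b x *ᵥ v = -(b ⬝ᵥ linearization π a x *ᵥ v) := by
  rw [← hπ.fderiv_dotProduct_mulVec, ← hπ.fderiv_dotProduct_mulVec,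
    funext fun x => hπ.dotProduct_mulVec x a b, fderiv_fun_neg]
  rfl

theorem bracket_eq_fderiv (f g : Pt n → ℝ) (x : Pt n) :
    bracket π f g x = fderiv ℝ f x (π x *ᵥ differential g x) := by
  rw [← differential_dotProduct]
  simp only [bracket, differential, dotProduct, mulVec, Finset.mul_sum]
  exact Finset.sum_congr rfl fun i _ => Finset.sum_congr rfl fun j _ => by ring

theorem IsPoissonTensor.jacobi_linear (hπ : IsPoissonTensor π) (a b c x : Pt n) :
    a ⬝ᵥ linearization π b x *ᵥ π x *ᵥ c + c ⬝ᵥ linearization π a x *ᵥ π x *ᵥ b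
      + b ⬝ᵥ linearization π c x *ᵥ π x *ᵥ a = 0 := by
  have hlin (a x : Pt n) : HasFDerivAt (fun x => a ⬝ᵥ x)
      (dotProductBilin ℝ ℝ a).toContinuousLinearMap x :=
    (dotProductBilin ℝ ℝ a).toContinuousLinearMap.hasFDerivAt
  have hdiff (a x : Pt n) : differential (fun x => a ⬝ᵥ x) x = a := by
    refine dotProduct_eq _ _ fun v => ?_
    rw [differential_dotProduct, (hlin a x).fderiv]
    rfl
  have hbracket (a b : Pt n) :
      bracket π (fun x => a ⬝ᵥ x) (fun x => b ⬝ᵥ x) = fun x => a ⬝ᵥ π x *ᵥ b := by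
    funext x
    rw [bracket_eq_fderiv, hdiff, (hlin a x).fderiv]
    rfl
  have hsmooth (a : Pt n) : ContDiff ℝ ∞ fun x : Pt n => a ⬝ᵥ x :=
    (dotProductBilin ℝ ℝ a).toContinuousLinearMap.contDiff
  have h := hπ.jacobi _ _ _ (hsmooth a) (hsmooth b) (hsmooth c) x
  simpa only [hbracket, bracket_eq_fderiv, hdiff, hπ.fderiv_dotProduct_mulVec] using h

-- the flow of the spray velocity `x ↦ π(x) p` preserves `π`
theorem IsPoissonTensor.linearization_mulVec_comm (hπ : IsPoissonTensor π) (p θ x : Pt n) :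
    linearization π θ x *ᵥ π x *ᵥ p
      = linearization π p x *ᵥ π x *ᵥ θ + π x *ᵥ (linearization π p x)ᵀ *ᵥ θ := by
  refine dotProduct_eq _ _ fun a => ?_
  rw [dotProduct_comm _ a, dotProduct_comm _ a, dotProduct_add, hπ.dotProduct_mulVec x a,
    mulVec_transpose, ← Matrix.dotProduct_mulVec]
  linarith [hπ.jacobi_linear a θ p x, hπ.dotProduct_linearization p a x (π x *ᵥ θ)]

theorem IsPoissonTensor.fderiv_mulVec (hπ : IsPoissonTensor π) (x p η q : Pt n) :
    fderiv ℝ (fun z : Pt n × Pt n => π z.1 *ᵥ z.2) (x, p) (η, q)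
      = linearization π p x *ᵥ η + π x *ᵥ q := by
  have hF : HasFDerivAt (fun z : Pt n × Pt n => π z.1 *ᵥ z.2) _ (x, p) :=
    (hπ.contDiff_mulVec.differentiable (by simp) _).hasFDerivAt
  have hpos := hF.comp (f := fun x => (x, p)) x ((hasFDerivAt_id x).prodMk (hasFDerivAt_const p x))
  have hmom := hF.comp (f := fun q => (x, q)) p ((hasFDerivAt_const x p).prodMk (hasFDerivAt_id p))
  have hη := congrArg (· η) hpos.fderiv
  have hq := congrArg (· q) (hmom.unique ((π x).mulVecLin.toContinuousLinearMap.hasFDerivAt))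
  rw [show (η, q) = (η, 0) + (0, q) by simp, map_add, linearization_mulVec]
  exact congrArg₂ (· + ·) hη.symm hq

theorem IsPoissonTensor.hasDerivWithinAt_mulVec (hπ : IsPoissonTensor π) {y θ : ℝ → Pt n}
    {y' θ' : Pt n} {s : Set ℝ} {t : ℝ} (hy : HasDerivWithinAt y y' s t)
    (hθ : HasDerivWithinAt θ θ' s t) :
    HasDerivWithinAt (fun t => π (y t) *ᵥ θ t)
      (linearization π (θ t) (y t) *ᵥ y' + π (y t) *ᵥ θ') s t := by
  have hF := (hπ.contDiff_mulVec.differentiable (by simp) (y t, θ t)).hasFDerivAt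
  exact (hF.comp_hasDerivWithinAt t (hy.prodMk hθ)).congr_deriv (hπ.fderiv_mulVec _ _ _ _)

theorem IsPoissonTensor.fderiv_spray (hπ : IsPoissonTensor π) (x p η q : Pt n) :
    fderiv ℝ (spray π) (x, p) (η, q) = (linearization π p x *ᵥ η + π x *ᵥ q, 0) := by
  have hF := (hπ.contDiff_mulVec.differentiable (by simp) (x, p)).hasFDerivAt
  rw [funext hπ.spray_eq, (hF.prodMk (hasFDerivAt_const 0 _)).fderiv, ← hπ.fderiv_mulVec]
  rfl

end Poisson

/-! ### Variations of the curves that define the realization map -/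

section Variation

variable {n : ℕ} {π : Pt n → Matrix (Fin n) (Fin n) ℝ} {ε : ℝ} {U : Set (Pt n × Pt n)}
  {α : Pt n × Pt n → Pt n} {y : Pt n × Pt n → ℝ → Pt n} {z Y : Pt n × Pt n}

/-- A choice `y z`, for `z ∈ U`, of the base curves of the spray trajectories that start at
`(α z, z.2)` and whose averages define the realization map `α`. -/
structure IsBaseCurveFamily (π : Pt n → Matrix (Fin n) (Fin n) ℝ) (ε : ℝ) (U : Set (Pt n × Pt n))
    (α : Pt n × Pt n → Pt n) (y : Pt n × Pt n → ℝ → Pt n) : Prop where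
  start : ∀ z ∈ U, y z 0 = α z
  curve : ∀ z ∈ U, IsIntegralCurveOn (y z) (fun _ x => π x *ᵥ z.2) (Icc 0 ε)
  integral : ∀ z ∈ U, ∫ s in (0 : ℝ)..ε, y z s = ε • z.1

theorem IsPoissonTensor.isIntegralCurveOn_spray (hπ : IsPoissonTensor π) {x : ℝ → Pt n} {p : Pt n}
    (h : IsIntegralCurveOn x (fun _ x => π x *ᵥ p) (Icc 0 ε)) :
    IsIntegralCurveOn (fun s => (x s, p)) (fun _ => spray π) (Icc 0 ε) := fun s hs => by
  simp only [hπ.spray_eq]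
  exact (h s hs).prodMk (hasDerivWithinAt_const _ _ _)

theorem snd_eq_of_isIntegralCurveOn_spray {γ : ℝ → Pt n × Pt n}
    (h : IsIntegralCurveOn γ (fun _ => spray π) (Icc 0 ε)) {s : ℝ} (hs : s ∈ Icc 0 ε) :
    (γ s).2 = (γ 0).2 :=
  constant_of_has_deriv_right_zero (f := fun s => (γ s).2)
    (continuous_snd.comp_continuousOn h.continuousOn)
    (fun t ht => (hasDerivWithinAt_Ici_of_Icc (h t (Ico_subset_Icc_self ht)) ht).snd) s hs

theorem IsKarasevMap.hasFDerivAt (hα : IsKarasevMap π ε U α) (hz : z ∈ U) :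
    HasFDerivAt α (fderiv ℝ α z) z :=
  ((hα.smooth.contDiffAt (hα.isOpen.mem_nhds hz)).differentiableAt (by simp)).hasFDerivAt

theorem IsKarasevMap.exists_isBaseCurveFamily (hπ : IsPoissonTensor π) (hα : IsKarasevMap π ε U α)
    (hε : ε ≠ 0) : ∃ y, IsBaseCurveFamily π ε U α y := by
  choose! γ hstart hcurve haverage using
    fun (z : Pt n × Pt n) (hz : z ∈ U) => hα.implicit z.1 z.2 hz
  refine ⟨fun z s => (γ z s).1, fun z hz => congrArg Prod.fst (hstart z hz), fun z hz s hs => ?_,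
    fun z hz => ?_⟩
  · refine (hasFDerivAt_fst.comp_hasDerivWithinAt s (hcurve z hz s hs)).congr_deriv ?_
    simp [hπ.spray_eq, snd_eq_of_isIntegralCurveOn_spray (hcurve z hz) hs, hstart z hz]
  · rw [← haverage z hz, xAverage, if_neg hε, smul_inv_smul₀ hε]

theorem IsKarasevMap.eventually_line_mem (hα : IsKarasevMap π ε U α) (hz : z ∈ U)
    (Y : Pt n × Pt n) : ∀ᶠ τ in 𝓝 (0 : ℝ), z + τ • Y ∈ U := by
  have h : Continuous fun τ : ℝ => z + τ • Y := by fun_prop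
  exact h.continuousAt.eventually (by simpa using hα.isOpen.mem_nhds hz)

theorem hasDerivAt_line {E : Type*} [NormedAddCommGroup E] [NormedSpace ℝ E] (z Y : E) :
    HasDerivAt (fun τ : ℝ => z + τ • Y) Y 0 := by
  simpa using ((hasDerivAt_id (0 : ℝ)).smul_const Y).const_add z

/-- The right-hand side of the linearized equation of the base curve `y z` for a variation whose
momentum component is `q`. -/
def variationField (π : Pt n → Matrix (Fin n) (Fin n) ℝ) (y : Pt n × Pt n → ℝ → Pt n)
    (z : Pt n × Pt n) (q : Pt n) (s : ℝ) (ξ : Pt n) : Pt n :=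
  linearization π z.2 (y z s) *ᵥ ξ + π (y z s) *ᵥ q

theorem IsBaseCurveFamily.continuousOn_linearization (hπ : IsPoissonTensor π)
    (hy : IsBaseCurveFamily π ε U α y) (hz : z ∈ U) :
    ContinuousOn (fun s => linearization π z.2 (y z s)) (Icc 0 ε) :=
  (hπ.continuous_linearization z.2).comp_continuousOn (hy.curve z hz).continuousOn

theorem continuous_mulVecLin :
    Continuous fun A : Matrix (Fin n) (Fin n) ℝ => A.mulVecLin.toContinuousLinearMap :=
  (LinearMap.toContinuousLinearMap.toLinearMap ∘ₗ
    (Matrix.toLin' (R := ℝ) (m := Fin n) (n := Fin n)).toLinearMap).continuous_of_finiteDimensional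

theorem IsBaseCurveFamily.exists_isIntegralCurveOn_variationField (hπ : IsPoissonTensor π)
    (hε : 0 ≤ ε) (hy : IsBaseCurveFamily π ε U α y) (hz : z ∈ U) (q ξ₀ : Pt n) :
    ∃ ξ, ξ 0 = ξ₀ ∧ IsIntegralCurveOn ξ (variationField π y z q) (Icc 0 ε) :=
  exists_isIntegralCurveOn_affine hε
    (continuous_mulVecLin.comp_continuousOn (hy.continuousOn_linearization hπ hz))
    ((hπ.contDiff_mulVec_const q).continuous.comp_continuousOn (hy.curve z hz).continuousOn) ξ₀

theorem IsBaseCurveFamily.eqOn_of_isIntegralCurveOn_variationField (hπ : IsPoissonTensor π)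
    (hy : IsBaseCurveFamily π ε U α y) (hz : z ∈ U) {q : Pt n} {ξ η : ℝ → Pt n}
    (hξ : IsIntegralCurveOn ξ (variationField π y z q) (Icc 0 ε))
    (hη : IsIntegralCurveOn η (variationField π y z q) (Icc 0 ε)) (h₀ : ξ 0 = η 0) :
    EqOn ξ η (Icc 0 ε) :=
  eqOn_of_isIntegralCurveOn_affine
    (continuous_mulVecLin.comp_continuousOn (hy.continuousOn_linearization hπ hz)) hξ hη h₀

/-- `ξ` is the first variation, in the direction `Y` at `z`, of the base curves `y`. -/
structure IsVariation (π : Pt n → Matrix (Fin n) (Fin n) ℝ) (ε : ℝ) (α : Pt n × Pt n → Pt n)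
    (y : Pt n × Pt n → ℝ → Pt n) (z Y : Pt n × Pt n) (ξ : ℝ → Pt n) : Prop where
  start : ξ 0 = fderiv ℝ α z Y
  ode : IsIntegralCurveOn ξ (variationField π y z Y.2) (Icc 0 ε)
  integral : ∫ s in (0 : ℝ)..ε, ξ s = ε • Y.1
  endpoint : HasDerivAt (fun τ : ℝ => y (z + τ • Y) ε) (ξ ε) 0

theorem IsBaseCurveFamily.tendstoUniformlyOn_slope (hπ : IsPoissonTensor π)
    (hα : IsKarasevMap π ε U α) (hy : IsBaseCurveFamily π ε U α y) (hz : z ∈ U)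
    {ξ : ℝ → Pt n} (hξ₀ : ξ 0 = fderiv ℝ α z Y)
    (hξ : IsIntegralCurveOn ξ (variationField π y z Y.2) (Icc 0 ε)) :
    TendstoUniformlyOn (fun τ s => slope (fun τ : ℝ => y (z + τ • Y) s) 0 τ) ξ (𝓝[≠] 0)
      (Icc 0 ε) := by
  let γ : ℝ → ℝ → Pt n × Pt n := fun τ s => (y (z + τ • Y) s, (z + τ • Y).2)
  have hU := hα.eventually_line_mem hz Y
  have hγ₀ : γ 0 = fun s => (y z s, z.2) := by simp [γ]
  have hγ : ∀ᶠ τ in 𝓝 0, IsIntegralCurveOn (γ τ) (fun _ => spray π) (Icc 0 ε) :=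
    hU.mono fun τ hτ => hπ.isIntegralCurveOn_spray (hy.curve _ hτ)
  have hlin : IsIntegralCurveOn (fun s => (ξ s, Y.2)) (fun s => fderiv ℝ (spray π) (γ 0 s))
      (Icc 0 ε) := fun s hs => by
    simp only [hγ₀, hπ.fderiv_spray]
    exact (hξ s hs).prodMk (hasDerivWithinAt_const _ _ _)
  have hinit : HasDerivAt (fun τ => γ τ 0) (ξ 0, Y.2) 0 := by
    have hline : HasDerivAt (fun τ : ℝ => (α (z + τ • Y), (z + τ • Y).2)) (ξ 0, Y.2) 0 :=
      (hξ₀ ▸ HasFDerivAt.comp_hasDerivAt_of_eq (0 : ℝ) (hα.hasFDerivAt hz) (hasDerivAt_line z Y)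
        (by simp)).prodMk (hasDerivAt_line z Y).snd
    exact hline.congr_of_eventuallyEq (hU.mono fun τ hτ => by simp only [γ, hy.start _ hτ])
  have huniform := tendstoUniformlyOn_slope_isIntegralCurveOn
    (hπ.contDiff_spray.of_le (by simp)) hγ hlin hinit
  simpa [slope_def_module, γ, Function.comp_def] using
    uniformContinuous_fst.comp_tendstoUniformlyOn huniform

theorem IsBaseCurveFamily.exists_isVariation (hπ : IsPoissonTensor π) (hε : 0 ≤ ε)
    (hα : IsKarasevMap π ε U α) (hy : IsBaseCurveFamily π ε U α y) (hz : z ∈ U)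
    (Y : Pt n × Pt n) : ∃ ξ, IsVariation π ε α y z Y ξ := by
  obtain ⟨ξ, hξ₀, hξ⟩ :=
    hy.exists_isIntegralCurveOn_variationField hπ hε hz Y.2 (fderiv ℝ α z Y)
  have hslope := hy.tendstoUniformlyOn_slope hπ hα hz hξ₀ hξ
  have hU : ∀ᶠ τ in 𝓝[≠] (0 : ℝ), z + τ • Y ∈ U :=
    (hα.eventually_line_mem hz Y).filter_mono nhdsWithin_le_nhds
  have hint : ∀ w ∈ U, IntervalIntegrable (y w) MeasureTheory.volume 0 ε := fun w hw =>
    (hy.curve w hw).continuousOn.intervalIntegrable_of_Icc hε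
  have hcont : ∀ᶠ τ in 𝓝[≠] (0 : ℝ),
      ContinuousOn (fun s => slope (fun τ : ℝ => y (z + τ • Y) s) 0 τ) (Icc 0 ε) := by
    filter_upwards [hU] with τ hτ
    simp only [slope_def_module, zero_smul, add_zero]
    exact ((hy.curve _ hτ).continuousOn.sub (hy.curve z hz).continuousOn).const_smul (τ - 0)⁻¹
  have hslope_integral : ∀ᶠ τ in 𝓝[≠] (0 : ℝ),
      ∫ s in (0 : ℝ)..ε, slope (fun τ : ℝ => y (z + τ • Y) s) 0 τ = ε • Y.1 := by
    filter_upwards [hU, eventually_mem_nhdsWithin] with τ hτ hτ₀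
    simp only [slope_def_module, zero_smul, add_zero, sub_zero, intervalIntegral.integral_smul]
    rw [intervalIntegral.integral_sub (hint _ hτ) (hint z hz), hy.integral _ hτ, hy.integral z hz,
      Prod.fst_add, Prod.smul_fst, smul_add, add_sub_cancel_left, smul_comm ε, inv_smul_smul₀ hτ₀]
  refine ⟨ξ, hξ₀, hξ, ?_, hasDerivAt_iff_tendsto_slope.2
    (hslope.tendsto_at (right_mem_Icc.2 hε))⟩
  rw [← uIcc_of_le hε] at hslope hcont
  exact tendsto_nhds_unique
    (TendstoUniformlyOn.tendsto_intervalIntegral_of_continuousOn hcont hslope)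
    (tendsto_const_nhds.congr' (hslope_integral.mono fun _ h => h.symm))

theorem IsBaseCurveFamily.fderiv_inl_injective (hπ : IsPoissonTensor π) (hε : 0 < ε)
    (hα : IsKarasevMap π ε U α) (hy : IsBaseCurveFamily π ε U α y) (hz : z ∈ U) :
    Function.Injective ((fderiv ℝ α z).comp (.inl ℝ (Pt n) (Pt n))) := by
  refine (injective_iff_map_eq_zero _).2 fun v hv => ?_
  obtain ⟨ξ, hξ⟩ := hy.exists_isVariation hπ hε.le hα hz (v, 0)
  have hzero : IsIntegralCurveOn (fun _ => 0) (variationField π y z 0) (Icc 0 ε) := fun s _ => by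
    simpa [variationField] using hasDerivWithinAt_const s (Icc 0 ε) (0 : Pt n)
  have hξ_zero : EqOn ξ (fun _ => 0) (Icc 0 ε) :=
    hy.eqOn_of_isIntegralCurveOn_variationField hπ hz hξ.ode hzero (hξ.start.trans hv)
  have hintegral := hξ.integral
  rw [intervalIntegral.integral_congr (by rwa [uIcc_of_le hε.le])] at hintegral
  simpa [hε.ne'] using hintegral.symm

theorem IsBaseCurveFamily.exists_fderiv_inl_eq (hπ : IsPoissonTensor π) (hε : 0 < ε)
    (hα : IsKarasevMap π ε U α) (hy : IsBaseCurveFamily π ε U α y) (hz : z ∈ U) (w : Pt n) :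
    ∃ v : Pt n, fderiv ℝ α z (v, 0) = w :=
  LinearMap.surjective_of_injective
    (f := ((fderiv ℝ α z).comp (.inl ℝ (Pt n) (Pt n))).toLinearMap)
    (hy.fderiv_inl_injective hπ hε hα hz) w

theorem IsVariation.eqOn_of_integral_eq (hπ : IsPoissonTensor π) (hε : 0 < ε)
    (hα : IsKarasevMap π ε U α) (hy : IsBaseCurveFamily π ε U α y) (hz : z ∈ U)
    {ξ ζ : ℝ → Pt n} (hξ : IsVariation π ε α y z Y ξ)
    (hζ : IsIntegralCurveOn ζ (variationField π y z Y.2) (Icc 0 ε))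
    (hint : ∫ s in (0 : ℝ)..ε, ζ s = ∫ s in (0 : ℝ)..ε, ξ s) : EqOn ζ ξ (Icc 0 ε) := by
  obtain ⟨v, hv⟩ := hy.exists_fderiv_inl_eq hπ hε hα hz (ζ 0 - ξ 0)
  obtain ⟨η, hη⟩ := hy.exists_isVariation hπ hε.le hα hz (Y + (v, 0))
  have hode := hη.ode
  rw [Prod.snd_add, add_zero] at hode
  have hζη : EqOn ζ η (Icc 0 ε) :=
    hy.eqOn_of_isIntegralCurveOn_variationField hπ hz hζ hode
      (by rw [hη.start, map_add, hv, ← hξ.start, add_sub_cancel])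
  have hv₀ : v = 0 := by
    rw [intervalIntegral.integral_congr (by rwa [uIcc_of_le hε.le]), hη.integral,
      hξ.integral] at hint
    simpa [hε.ne'] using hint
  refine hy.eqOn_of_isIntegralCurveOn_variationField hπ hz hζ hξ.ode (sub_eq_zero.1 ?_)
  rw [← hv, hv₀]
  exact map_zero _

theorem hasDerivWithinAt_dotProduct {f g : ℝ → Pt n} {f' g' : Pt n} {s : Set ℝ} {t : ℝ}
    (hf : HasDerivWithinAt f f' s t) (hg : HasDerivWithinAt g g' s t) :
    HasDerivWithinAt (fun t => f t ⬝ᵥ g t) (f t ⬝ᵥ g' + f' ⬝ᵥ g t) s t :=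
  (dotProductBilin (m := Fin n) ℝ ℝ).toContinuousBilinearMap.hasDerivWithinAt_of_bilinear hf hg

theorem intervalIntegral_dotProduct {a b : ℝ} {f : ℝ → Pt n}
    (hf : IntervalIntegrable f MeasureTheory.volume a b) (v : Pt n) :
    ∫ s in a..b, v ⬝ᵥ f s = v ⬝ᵥ ∫ s in a..b, f s :=
  (dotProductBilin (m := Fin n) ℝ ℝ v).toContinuousLinearMap.intervalIntegral_comp_comm hf

/-- `θ` solves the terminal value problem adjoint to the linearized equation of the base curve
`y z`, with forcing term `q`. -/
structure IsAdjointVariation (π : Pt n → Matrix (Fin n) (Fin n) ℝ) (ε : ℝ)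
    (y : Pt n × Pt n → ℝ → Pt n) (z : Pt n × Pt n) (q : Pt n) (θ : ℝ → Pt n) : Prop where
  terminal : θ ε = 0
  ode : IsIntegralCurveOn θ (fun s x => -((linearization π z.2 (y z s))ᵀ *ᵥ x) + q) (Icc 0 ε)

theorem IsBaseCurveFamily.exists_isAdjointVariation (hπ : IsPoissonTensor π) (hε : 0 ≤ ε)
    (hy : IsBaseCurveFamily π ε U α y) (hz : z ∈ U) (q : Pt n) :
    ∃ θ, IsAdjointVariation π ε y z q θ := by
  have hA : ContinuousOn (fun s => -(linearization π z.2 (y z s))ᵀ) (Icc 0 ε) :=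
    (continuous_id.matrix_transpose.comp_continuousOn (hy.continuousOn_linearization hπ hz)).neg
  obtain ⟨θ, hterminal, hode⟩ := exists_isIntegralCurveOn_affine_terminal (g := fun _ => q) hε
    (continuous_mulVecLin.comp_continuousOn hA) continuousOn_const 0
  exact ⟨θ, hterminal, fun s hs => (hode s hs).congr_deriv (by simp [mulVec_transpose])⟩

theorem IsAdjointVariation.isIntegralCurveOn_mulVec (hπ : IsPoissonTensor π)
    (hy : IsBaseCurveFamily π ε U α y) (hz : z ∈ U) {q : Pt n} {θ : ℝ → Pt n}
    (hθ : IsAdjointVariation π ε y z q θ) :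
    IsIntegralCurveOn (fun s => π (y z s) *ᵥ θ s) (variationField π y z q) (Icc 0 ε) :=
  fun s hs => by
    refine (hπ.hasDerivWithinAt_mulVec (hy.curve z hz s hs) (hθ.ode s hs)).congr_deriv ?_
    rw [hπ.linearization_mulVec_comm, mulVec_add, mulVec_neg, variationField]
    abel

-- integrate `(θ ⬝ᵥ ξ)' = q ⬝ᵥ ξ - Y.2 ⬝ᵥ π θ`
theorem IsAdjointVariation.green (hπ : IsPoissonTensor π) (hε : 0 ≤ ε)
    (hy : IsBaseCurveFamily π ε U α y) (hz : z ∈ U) {q : Pt n} {θ ξ : ℝ → Pt n}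
    (hθ : IsAdjointVariation π ε y z q θ) (hξ : IsVariation π ε α y z Y ξ) :
    ε * (q ⬝ᵥ Y.1) - Y.2 ⬝ᵥ ∫ s in (0 : ℝ)..ε, π (y z s) *ᵥ θ s
      = -(θ 0 ⬝ᵥ fderiv ℝ α z Y) := by
  have hderiv : ∀ s ∈ Icc 0 ε, HasDerivWithinAt (fun s => θ s ⬝ᵥ ξ s)
      (q ⬝ᵥ ξ s - Y.2 ⬝ᵥ π (y z s) *ᵥ θ s) (Icc 0 ε) s := fun s hs => by
    refine (hasDerivWithinAt_dotProduct (hθ.ode s hs) (hξ.ode s hs)).congr_deriv ?_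
    rw [variationField, dotProduct_add, add_dotProduct, neg_dotProduct, mulVec_transpose,
      ← dotProduct_mulVec, hπ.dotProduct_mulVec _ (θ s)]
    ring
  have hξ_int : IntervalIntegrable ξ MeasureTheory.volume 0 ε :=
    hξ.ode.continuousOn.intervalIntegrable_of_Icc hε
  have hπθ_int : IntervalIntegrable (fun s => π (y z s) *ᵥ θ s) MeasureTheory.volume 0 ε :=
    (hθ.isIntegralCurveOn_mulVec hπ hy hz).continuousOn.intervalIntegrable_of_Icc hε
  have hdot_int (v : Pt n) {f : ℝ → Pt n} (hf : IntervalIntegrable f MeasureTheory.volume 0 ε) :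
      IntervalIntegrable (fun s => v ⬝ᵥ f s) MeasureTheory.volume 0 ε :=
    let L := (dotProductBilin (m := Fin n) ℝ ℝ v).toContinuousLinearMap
    ⟨L.integrable_comp hf.1, L.integrable_comp hf.2⟩
  calc ε * (q ⬝ᵥ Y.1) - Y.2 ⬝ᵥ ∫ s in (0 : ℝ)..ε, π (y z s) *ᵥ θ s
      = ∫ s in (0 : ℝ)..ε, (q ⬝ᵥ ξ s - Y.2 ⬝ᵥ π (y z s) *ᵥ θ s) := by
        rw [intervalIntegral.integral_sub (hdot_int q hξ_int) (hdot_int Y.2 hπθ_int),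
          intervalIntegral_dotProduct hξ_int, intervalIntegral_dotProduct hπθ_int, hξ.integral,
          dotProduct_smul, smul_eq_mul]
    _ = θ ε ⬝ᵥ ξ ε - θ 0 ⬝ᵥ ξ 0 :=
        intervalIntegral.integral_eq_sub_of_hasDerivAt_of_le hε
          (fun s hs => (hderiv s hs).continuousWithinAt)
          (fun s hs => (hderiv s (Ioo_subset_Icc_self hs)).hasDerivAt (Icc_mem_nhds hs.1 hs.2))
          ((hdot_int q hξ_int).sub (hdot_int Y.2 hπθ_int))
    _ = -(θ 0 ⬝ᵥ fderiv ℝ α z Y) := by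
        rw [hθ.terminal, zero_dotProduct, zero_sub, hξ.start]

theorem IsAdjointVariation.integral_eq_smul_hamiltonianField (hπ : IsPoissonTensor π)
    (hε : 0 < ε) (hα : IsKarasevMap π ε U α) (hy : IsBaseCurveFamily π ε U α y) (hz : z ∈ U)
    {f : Pt n → ℝ} (hf : DifferentiableAt ℝ f (α z)) {θ : ℝ → Pt n}
    (hθ : IsAdjointVariation π ε y z (hamiltonianField (f ∘ α) z).2 θ) :
    ∫ s in (0 : ℝ)..ε, π (y z s) *ᵥ θ s = ε • (hamiltonianField (f ∘ α) z).1 := by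
  set X := hamiltonianField (f ∘ α) z
  set I := ∫ s in (0 : ℝ)..ε, π (y z s) *ᵥ θ s
  have hchain (Y : Pt n × Pt n) :
      X.2 ⬝ᵥ Y.1 - X.1 ⬝ᵥ Y.2 = fderiv ℝ f (α z) (fderiv ℝ α z Y) := by
    rw [hamiltonianField_pairing, fderiv_comp z hf (hα.hasFDerivAt hz).differentiableAt]
    rfl
  have hgreen (Y : Pt n × Pt n) : ε * (X.2 ⬝ᵥ Y.1) - Y.2 ⬝ᵥ I = -(θ 0 ⬝ᵥ fderiv ℝ α z Y) := by
    obtain ⟨ξ, hξ⟩ := hy.exists_isVariation hπ hε.le hα hz Y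
    exact hθ.green hπ hε.le hy hz hξ
  have hθ₀ (w : Pt n) : θ 0 ⬝ᵥ w = -(ε * fderiv ℝ f (α z) w) := by
    obtain ⟨v, rfl⟩ := hy.exists_fderiv_inl_eq hπ hε hα hz w
    have h := hgreen (v, 0)
    simp only [zero_dotProduct, sub_zero] at h
    rw [← hchain, dotProduct_zero, sub_zero, h, neg_neg]
  refine dotProduct_eq _ _ fun w => ?_
  have h := hgreen (0, w)
  rw [hθ₀, ← hchain] at h
  simp only [dotProduct_zero] at h
  rw [smul_dotProduct, smul_eq_mul, dotProduct_comm]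
  linarith

theorem IsVariation.endpoint_eq_zero (hπ : IsPoissonTensor π) (hε : 0 < ε)
    (hα : IsKarasevMap π ε U α) (hy : IsBaseCurveFamily π ε U α y) (hz : z ∈ U)
    {f : Pt n → ℝ} (hf : DifferentiableAt ℝ f (α z)) {η : ℝ → Pt n}
    (hη : IsVariation π ε α y z (hamiltonianField (f ∘ α) z) η) : η ε = 0 := by
  obtain ⟨θ, hθ⟩ :=
    hy.exists_isAdjointVariation hπ hε.le hz (hamiltonianField (f ∘ α) z).2
  have hπθ : EqOn (fun s => π (y z s) *ᵥ θ s) η (Icc 0 ε) :=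
    hη.eqOn_of_integral_eq hπ hε hα hy hz (hθ.isIntegralCurveOn_mulVec hπ hy hz)
      ((hθ.integral_eq_smul_hamiltonianField hπ hε hα hy hz hf).trans hη.integral.symm)
  simpa [hθ.terminal] using (hπθ (right_mem_Icc.2 hε.le)).symm

/-! ### The realization map and its dual -/

/-- The reflection `(x, p) ↦ (x, -p)` of `T*M`, which exchanges the realization map and its
dual. -/
def reflect (z : Pt n × Pt n) : Pt n × Pt n := (z.1, -z.2)

theorem contDiff_reflect : ContDiff ℝ ∞ (reflect (n := n)) :=
  contDiff_fst.prodMk contDiff_snd.neg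

theorem IsKarasevMap.reflect_mem (hα : IsKarasevMap π ε U α) (hz : z ∈ U) : reflect z ∈ U :=
  hα.neg_mem z.1 z.2 hz

theorem IsKarasevMap.contDiffAt (hα : IsKarasevMap π ε U α) (hz : z ∈ U) : ContDiffAt ℝ ∞ α z :=
  hα.smooth.contDiffAt (hα.isOpen.mem_nhds hz)

theorem IsKarasevMap.contDiffAt_comp_reflect (hα : IsKarasevMap π ε U α) (hz : z ∈ U) :
    ContDiffAt ℝ ∞ (α ∘ reflect) z :=
  (hα.contDiffAt (hα.reflect_mem hz)).comp z contDiff_reflect.contDiffAt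

theorem SprayAverage.unique (hπ : IsPoissonTensor π) (hε : 0 ≤ ε) {y p x x' : Pt n}
    (h : SprayAverage π ε y p x) (h' : SprayAverage π ε y p x') : x = x' := by
  obtain ⟨γ, hγ₀, hγ, rfl⟩ := h
  obtain ⟨γ', hγ'₀, hγ', rfl⟩ := h'
  have heq : EqOn γ γ' (Icc 0 ε) :=
    eqOn_of_isIntegralCurveOn (hπ.contDiff_spray.of_le (by simp)) hγ hγ' (hγ₀.trans hγ'₀.symm)
  have hint : ∫ s in (0 : ℝ)..ε, (γ s).1 = ∫ s in (0 : ℝ)..ε, (γ' s).1 :=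
    intervalIntegral.integral_congr fun s hs => by
      simp only [heq (uIcc_of_le hε ▸ hs)]
  rw [xAverage, xAverage, hint, hγ₀, hγ'₀]

-- run the base curve backwards in time
theorem IsBaseCurveFamily.sprayAverage_endpoint (hπ : IsPoissonTensor π) (hε : ε ≠ 0)
    (hy : IsBaseCurveFamily π ε U α y) (hz : z ∈ U) : SprayAverage π ε (y z ε) (-z.2) z.1 := by
  have hmaps : MapsTo (fun s : ℝ => ε - s) (Icc 0 ε) (Icc 0 ε) := fun s hs =>
    ⟨by linarith [hs.2], by linarith [hs.1]⟩
  have hcurve : IsIntegralCurveOn (fun s => y z (ε - s)) (fun _ x => π x *ᵥ -z.2) (Icc 0 ε) :=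
    fun s hs => by
      refine ((hy.curve z hz (ε - s) (hmaps hs)).scomp s
        ((hasDerivAt_id s).const_sub ε).hasDerivWithinAt hmaps).congr_deriv ?_
      simp [mulVec_neg]
  have hintegral : ∫ s in (0 : ℝ)..ε, y z (ε - s) = ε • z.1 := by
    rw [intervalIntegral.integral_comp_sub_left, sub_self, sub_zero, hy.integral z hz]
  exact ⟨fun s => (y z (ε - s), -z.2), by simp, hπ.isIntegralCurveOn_spray hcurve,
    by rw [xAverage, if_neg hε, hintegral, inv_smul_smul₀ hε]⟩

theorem IsBaseCurveFamily.continuousAt_endpoint (hπ : IsPoissonTensor π) (hε : 0 ≤ ε)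
    (hα : IsKarasevMap π ε U α) (hy : IsBaseCurveFamily π ε U α y) (hz : z ∈ U) :
    ContinuousAt (fun w => y w ε) z := by
  have hspray (w : Pt n × Pt n) (hw : w ∈ U) :
      IsIntegralCurveOn (fun s => (y w s, w.2)) (fun _ => spray π) (Icc 0 ε) :=
    hπ.isIntegralCurveOn_spray (hy.curve w hw)
  obtain ⟨C, hC⟩ := exists_eventually_dist_isIntegralCurveOn_le
    (hπ.contDiff_spray.of_le (by simp)) (hspray z hz)
  have hstart : Tendsto (fun w => (α w, w.2)) (𝓝 z) (𝓝 (y z 0, z.2)) := by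
    rw [hy.start z hz]
    exact (hα.contDiffAt hz).continuousAt.prodMk_nhds continuousAt_snd
  have hbound : Tendsto (fun w => C * dist (α w, w.2) (y z 0, z.2)) (𝓝 z) (𝓝 0) := by
    simpa using (tendsto_iff_dist_tendsto_zero.1 hstart).const_mul (C : ℝ)
  refine tendsto_iff_dist_tendsto_zero.2 (squeeze_zero' (.of_forall fun _ => dist_nonneg) ?_ hbound)
  filter_upwards [hstart.eventually hC, hα.isOpen.mem_nhds hz] with w hw hwU
  exact (le_max_left _ _).trans
    (hw _ (by simp only [hy.start w hwU]) (hspray w hwU) ε (right_mem_Icc.2 hε))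

-- by invertibility of `∂α/∂x`, the map `(x, p) ↦ (α (x, p), p)` is open at `z`
theorem IsKarasevMap.eventually_eq_of_sprayAverage (hπ : IsPoissonTensor π) (hε : 0 < ε)
    (hα : IsKarasevMap π ε U α) (hz : z ∈ U) :
    ∀ᶠ q in 𝓝 (α z, z.2), ∀ x, SprayAverage π ε q.1 q.2 x → q.1 = α (x, q.2) := by
  obtain ⟨y, hy⟩ := hα.exists_isBaseCurveFamily hπ hε.ne'
  have hstrict : HasStrictFDerivAt (fun w : Pt n × Pt n => (α w, w.2))
      ((fderiv ℝ α z).prod (.snd ℝ (Pt n) (Pt n))) z :=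
    ((hα.contDiffAt hz).hasStrictFDerivAt (by simp)).prodMk hasStrictFDerivAt_snd
  have hsurj : ((fderiv ℝ α z).prod (.snd ℝ (Pt n) (Pt n))).range = ⊤ := by
    refine LinearMap.range_eq_top.2 fun w => ?_
    obtain ⟨v, hv⟩ := hy.exists_fderiv_inl_eq hπ hε hα hz (w.1 - fderiv ℝ α z (0, w.2))
    refine ⟨(v, 0) + (0, w.2), Prod.ext ?_ (by simp)⟩
    simp [-Prod.mk_add_mk, hv]
  rw [← hstrict.map_nhds_eq_of_surj hsurj, eventually_map]
  filter_upwards [hα.isOpen.mem_nhds hz] with w hw x hx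
  rw [hx.unique hπ hε.le (hα.implicit w.1 w.2 hw)]

/-- The points of `U` at which the dual realization map `α ∘ reflect` is given by the endpoints of
the base curves. -/
def dualitySet (ε : ℝ) (U : Set (Pt n × Pt n)) (α : Pt n × Pt n → Pt n)
    (y : Pt n × Pt n → ℝ → Pt n) : Set (Pt n × Pt n) :=
  {z | z ∈ U ∧ y z ε = α (reflect z)}

theorem IsBaseCurveFamily.isOpen_dualitySet (hπ : IsPoissonTensor π) (hε : 0 < ε)
    (hα : IsKarasevMap π ε U α) (hy : IsBaseCurveFamily π ε U α y) :
    IsOpen (dualitySet ε U α y) := by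
  refine isOpen_iff_mem_nhds.2 fun z ⟨hz, hzd⟩ => ?_
  have hendpoint : Tendsto (fun w => (y w ε, -w.2)) (𝓝 z) (𝓝 (α (reflect z), (reflect z).2)) := by
    rw [← hzd]
    exact (hy.continuousAt_endpoint hπ hε.le hα hz).prodMk_nhds continuous_snd.neg.continuousAt
  filter_upwards [hα.isOpen.mem_nhds hz,
    hendpoint.eventually (hα.eventually_eq_of_sprayAverage hπ hε (hα.reflect_mem hz))] with w hwU hw
  exact ⟨hwU, hw w.1 (hy.sprayAverage_endpoint hπ hε.ne' hwU)⟩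

theorem IsBaseCurveFamily.mem_dualitySet_of_mem_closure (hπ : IsPoissonTensor π) (hε : 0 ≤ ε)
    (hα : IsKarasevMap π ε U α) (hy : IsBaseCurveFamily π ε U α y) (hz : z ∈ U)
    (hcl : z ∈ closure (dualitySet ε U α y)) : z ∈ dualitySet ε U α y := by
  have := mem_closure_iff_nhdsWithin_neBot.1 hcl
  have hendpoint := (hy.continuousAt_endpoint hπ hε hα hz).mono_left
    (nhdsWithin_le_nhds (s := dualitySet ε U α y))
  have hdual := (hα.contDiffAt_comp_reflect hz).continuousAt.mono_left
    (nhdsWithin_le_nhds (s := dualitySet ε U α y))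
  exact ⟨hz, tendsto_nhds_unique_of_eventuallyEq hendpoint hdual
    (eventually_mem_nhdsWithin.mono fun w hw => hw.2)⟩

theorem IsBaseCurveFamily.zero_mem_dualitySet (hε : 0 ≤ ε)
    (hα : IsKarasevMap π ε U α) (hy : IsBaseCurveFamily π ε U α y) (x : Pt n) :
    (x, 0) ∈ dualitySet ε U α y := by
  have hz := hα.zero_mem x
  have hconst := constant_of_has_deriv_right_zero (hy.curve _ hz).continuousOn fun s hs => by
    simpa using hasDerivWithinAt_Ici_of_Icc (hy.curve _ hz s (Ico_subset_Icc_self hs)) hs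
  refine ⟨hz, ?_⟩
  rw [hconst ε (right_mem_Icc.2 hε), hy.start _ hz, reflect, neg_zero]

theorem IsBaseCurveFamily.fderiv_comp_reflect_hamiltonianField (hπ : IsPoissonTensor π)
    (hε : 0 < ε) (hα : IsKarasevMap π ε U α) (hy : IsBaseCurveFamily π ε U α y)
    (hz : z ∈ dualitySet ε U α y) {f : Pt n → ℝ} (hf : DifferentiableAt ℝ f (α z)) :
    fderiv ℝ (α ∘ reflect) z (hamiltonianField (f ∘ α) z) = 0 := by
  set X := hamiltonianField (f ∘ α) z
  obtain ⟨η, hη⟩ := hy.exists_isVariation hπ hε.le hα hz.1 X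
  have hline := hasDerivAt_line z X
  have hdual : HasDerivAt (fun τ : ℝ => α (reflect (z + τ • X)))
      (fderiv ℝ (α ∘ reflect) z X) 0 :=
    HasFDerivAt.comp_hasDerivAt_of_eq (l := α ∘ reflect) (0 : ℝ)
      ((hα.contDiffAt_comp_reflect hz.1).differentiableAt (by simp)).hasFDerivAt hline (by simp)
  have hmem : ∀ᶠ τ in 𝓝 (0 : ℝ), z + τ • X ∈ dualitySet ε U α y :=
    hline.continuousAt.eventually (by simpa using (hy.isOpen_dualitySet hπ hε hα).mem_nhds hz)
  rw [hdual.unique (hη.endpoint.congr_of_eventuallyEq (hmem.mono fun τ hτ => hτ.2.symm))]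
  exact hη.endpoint_eq_zero hπ hε hα hy hz.1 hf

/-- The failure of `G` to be invariant under `reflect`. -/
def reflectionDefect (G : Pt n × Pt n → ℝ) (z : Pt n × Pt n) : ℝ := G z - G (reflect z)

/-- `D` is an open neighbourhood of the zero section, closed relative to `U`, on which `G` Poisson
commutes with `G ∘ reflect`; the latter is stated as constancy of `reflectionDefect G` along the
Hamiltonian vector field of `G`. -/
structure IsCommutationDomain (U : Set (Pt n × Pt n)) (G : Pt n × Pt n → ℝ)
    (D : Set (Pt n × Pt n)) : Prop where
  isOpen : IsOpen D
  zero_mem : ∀ x, (x, 0) ∈ D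
  mem_of_mem_closure : ∀ z ∈ U, z ∈ closure D → z ∈ D
  fderiv_reflectionDefect : ∀ z ∈ D,
    fderiv ℝ (reflectionDefect G) z (hamiltonianField G z) = 0

theorem IsBaseCurveFamily.isCommutationDomain_dualitySet (hπ : IsPoissonTensor π) (hε : 0 < ε)
    (hα : IsKarasevMap π ε U α) (hy : IsBaseCurveFamily π ε U α y) {H : Pt n → ℝ}
    (hH : Differentiable ℝ H) : IsCommutationDomain U (H ∘ α) (dualitySet ε U α y) where
  isOpen := hy.isOpen_dualitySet hπ hε hα
  zero_mem := hy.zero_mem_dualitySet hε.le hα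
  mem_of_mem_closure _ := hy.mem_dualitySet_of_mem_closure hπ hε.le hα
  fderiv_reflectionDefect z hz := by
    have hdual := (hα.contDiffAt_comp_reflect hz.1).differentiableAt (by simp)
    have hfderiv : fderiv ℝ (reflectionDefect (H ∘ α)) z
        = fderiv ℝ (H ∘ α) z - (fderiv ℝ H (α (reflect z))).comp (fderiv ℝ (α ∘ reflect) z) := by
      rw [← Function.comp_apply (f := α), ← fderiv_comp z (hH _) hdual]
      exact fderiv_fun_sub ((hH _).comp z (hα.hasFDerivAt hz.1).differentiableAt)
        ((hH _).comp z hdual)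
    simp [hfderiv, fderiv_hamiltonianField_self,
      hy.fderiv_comp_reflect_hamiltonianField hπ hε hα hz (hH _)]

theorem IsKarasevMap.eq_fst_of_zero (hα : IsKarasevMap π 0 U α) (hz : z ∈ U) : α z = z.1 := by
  obtain ⟨γ, hγ₀, -, haverage⟩ := hα.implicit z.1 z.2 hz
  rwa [xAverage, if_pos rfl, hγ₀] at haverage

theorem IsKarasevMap.isCommutationDomain_of_zero (hα : IsKarasevMap π 0 U α) (H : Pt n → ℝ) :
    IsCommutationDomain U (H ∘ α) U where
  isOpen := hα.isOpen
  zero_mem := hα.zero_mem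
  mem_of_mem_closure _ hz _ := hz
  fderiv_reflectionDefect z hz := by
    have hdefect : reflectionDefect (H ∘ α) =ᶠ[𝓝 z] fun _ => 0 := by
      filter_upwards [hα.isOpen.mem_nhds hz] with w hw
      simp only [reflectionDefect, Function.comp_apply, hα.eq_fst_of_zero hw,
        hα.eq_fst_of_zero (hα.reflect_mem hw)]
      exact sub_self _
    simp [hdefect.fderiv_eq]

theorem IsKarasevMap.exists_isCommutationDomain (hπ : IsPoissonTensor π) (hε : 0 ≤ ε)
    (hα : IsKarasevMap π ε U α) {H : Pt n → ℝ} (hH : Differentiable ℝ H) :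
    ∃ D, IsCommutationDomain U (H ∘ α) D := by
  rcases hε.eq_or_lt with rfl | hε
  · exact ⟨U, hα.isCommutationDomain_of_zero H⟩
  · obtain ⟨y, hy⟩ := hα.exists_isBaseCurveFamily hπ hε.ne'
    exact ⟨dualitySet ε U α y, hy.isCommutationDomain_dualitySet hπ hε hα hH⟩

end Variation

/-! ### Haar's uniqueness theorem -/

section Haar

section Cone

variable {X : Type*} [PseudoMetricSpace X] {x₀ : X} {C R : ℝ}

/-- The cone of height `R / C` over the ball of radius `R` around `x₀` at time `0`: the future
domain of dependence of that ball at propagation speed `C`. -/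
def dependenceCone (x₀ : X) (C R : ℝ) : Set (ℝ × X) :=
  {q | 0 ≤ q.1 ∧ C * q.1 + dist q.2 x₀ ≤ R}

theorem isCompact_dependenceCone [ProperSpace X] (hC : 0 < C) :
    IsCompact (dependenceCone x₀ C R) := by
  refine (isCompact_Icc.prod (isCompact_closedBall x₀ R)).of_isClosed_subset
    (s := Icc 0 (R / C) ×ˢ closedBall x₀ R) ?_ fun q ⟨h₀, hR⟩ => ⟨⟨h₀, ?_⟩, mem_closedBall.2 ?_⟩
  · exact (isClosed_le continuous_const continuous_fst).inter
      (isClosed_le (f := fun q : ℝ × X => C * q.1 + dist q.2 x₀) (by fun_prop) continuous_const)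
  · rw [le_div_iff₀' hC]
    linarith [dist_nonneg (x := q.2) (y := x₀)]
  · linarith [mul_nonneg hC.le h₀]

theorem eventually_dependenceCone_subset {s : Set (ℝ × X)} (hs : s ∈ 𝓝 (0, x₀)) (hC : 0 < C) :
    ∀ᶠ R in 𝓝[>] 0, dependenceCone x₀ C R ⊆ s := by
  obtain ⟨r, hr, hball⟩ := Metric.mem_nhds_iff.1 hs
  filter_upwards [Ioo_mem_nhdsGT (lt_min hr (mul_pos hC hr))] with R ⟨_, hR⟩ q ⟨hq₀, hq⟩
  obtain ⟨hRr, hRC⟩ := lt_min_iff.1 hR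
  refine hball (mem_ball.2 (max_lt ?_ ?_))
  · rw [Real.dist_eq, sub_zero, abs_of_nonneg hq₀]
    refine lt_of_mul_lt_mul_left ?_ hC.le
    linarith [dist_nonneg (x := q.2) (y := x₀)]
  · linarith [mul_nonneg hC.le hq₀]

end Cone

variable {E : Type*} [NormedAddCommGroup E] [NormedSpace ℝ E] {u : ℝ × E → ℝ} {x₀ : E} {C R : ℝ}

theorem mul_opNorm_le_of_forall_apply_le {L : E →L[ℝ] ℝ} {B : ℝ} (hC : 0 < C)
    (h : ∀ v, ‖v‖ ≤ C → L v ≤ B) : C * ‖L‖ ≤ B := by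
  have hB : 0 ≤ B := by simpa using h 0 (by simpa using hC.le)
  rw [mul_comm, ← le_div_iff₀ hC]
  refine L.opNorm_le_of_unit_norm (by positivity) fun v hv => ?_
  have hnorm : ‖C • v‖ ≤ C := by rw [norm_smul, hv, mul_one, Real.norm_of_nonneg hC.le]
  have hpos := h (C • v) hnorm
  have hneg := h (-(C • v)) (by rwa [norm_neg])
  rw [map_neg, map_smul, smul_eq_mul] at hneg
  rw [map_smul, smul_eq_mul] at hpos
  rw [Real.norm_eq_abs, abs_le]
  constructor
  · rw [neg_le, le_div_iff₀ hC]
    linarith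
  · rw [le_div_iff₀ hC]
    linarith

theorem mem_posTangentConeAt_dependenceCone {m : ℝ × E} (hm : m ∈ dependenceCone x₀ C R)
    (hm₀ : 0 < m.1) {v : E} (hv : ‖v‖ ≤ C) :
    (-1, v) ∈ posTangentConeAt (dependenceCone x₀ C R) m := by
  refine mem_posTangentConeAt_of_frequently_mem (Eventually.frequently ?_)
  filter_upwards [Ioo_mem_nhdsGT hm₀] with τ ⟨hτ₀, hτ⟩
  have hdist : dist (m.2 + τ • v) x₀ ≤ dist m.2 x₀ + τ * C := by
    calc dist (m.2 + τ • v) x₀ ≤ dist (m.2 + τ • v) m.2 + dist m.2 x₀ := dist_triangle _ _ _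
      _ = dist m.2 x₀ + τ * ‖v‖ := by
        rw [dist_self_add_left, norm_smul, Real.norm_of_nonneg hτ₀.le, add_comm]
      _ ≤ dist m.2 x₀ + τ * C := by gcongr
  have hR := hm.2
  constructor
  · simpa using hτ.le
  · simp only [Prod.fst_add, Prod.snd_add, Prod.smul_fst, Prod.smul_snd, smul_eq_mul]
    linarith

theorem mul_norm_fderiv_inr_le_of_isMaxOn {m : ℝ × E} (hC : 0 < C)
    (hmax : IsMaxOn u (dependenceCone x₀ C R) m) (hm : m ∈ dependenceCone x₀ C R)
    (hm₀ : 0 < m.1) (hu : DifferentiableAt ℝ u m) :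
    C * ‖(fderiv ℝ u m).comp (.inr ℝ ℝ E)‖ ≤ fderiv ℝ u m (1, 0) := by
  refine mul_opNorm_le_of_forall_apply_le hC fun v hv => ?_
  have h := hmax.localize.hasFDerivWithinAt_nonpos hu.hasFDerivAt.hasFDerivWithinAt
    (mem_posTangentConeAt_dependenceCone hm hm₀ hv)
  have hsplit : ((-1, v) : ℝ × E) = (0, v) - (1, 0) := by simp
  rw [hsplit, map_sub] at h
  simpa using h

/-- The time reversal `(t, x) ↦ (-t, x)`. -/
def timeReflect : ℝ × E →L[ℝ] ℝ × E :=
  (-ContinuousLinearMap.fst ℝ ℝ E).prod (.snd ℝ ℝ E)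

theorem timeReflect_apply (q : ℝ × E) : timeReflect q = (-q.1, q.2) :=
  rfl

theorem tendsto_timeReflect (x : E) : Tendsto timeReflect (𝓝 (0, x)) (𝓝 (0, x)) := by
  simpa [timeReflect_apply] using (timeReflect (E := E)).continuous.tendsto (0, x)

variable [ProperSpace E]

theorem nonpos_of_fderiv_lt (hC : 0 < C)
    (hd : ∀ q ∈ dependenceCone x₀ C R, DifferentiableAt ℝ u q)
    (h₀ : ∀ x ∈ closedBall x₀ R, u (0, x) ≤ 0)
    (hlt : ∀ q ∈ dependenceCone x₀ C R,
      fderiv ℝ u q (1, 0) < C * ‖(fderiv ℝ u q).comp (.inr ℝ ℝ E)‖) :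
    ∀ q ∈ dependenceCone x₀ C R, u q ≤ 0 := fun q hq => by
  obtain ⟨m, hm, hmax⟩ := (isCompact_dependenceCone hC).exists_isMaxOn ⟨q, hq⟩
    fun q hq => (hd q hq).continuousAt.continuousWithinAt
  refine (hmax hq).trans ?_
  rcases hm.1.eq_or_lt with hm₀ | hm₀
  · have hR := hm.2
    rw [← hm₀, mul_zero, zero_add] at hR
    simpa [← hm₀.symm] using h₀ m.2 hR
  · exact absurd (mul_norm_fderiv_inr_le_of_isMaxOn hC hmax hm hm₀ (hd m hm)) (hlt m hm).not_ge

theorem nonpos_of_fderiv_le (hC : 0 < C)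
    (hd : ∀ q ∈ dependenceCone x₀ C R, DifferentiableAt ℝ u q)
    (h₀ : ∀ x ∈ closedBall x₀ R, u (0, x) ≤ 0)
    (hle : ∀ q ∈ dependenceCone x₀ C R,
      fderiv ℝ u q (1, 0) ≤ C * ‖(fderiv ℝ u q).comp (.inr ℝ ℝ E)‖) :
    ∀ q ∈ dependenceCone x₀ C R, u q ≤ 0 := fun q hq => by
  have hperturbed (δ : ℝ) (hδ : 0 < δ) : u q - δ * q.1 ≤ 0 := by
    have hfderiv : ∀ q ∈ dependenceCone x₀ C R,
        HasFDerivAt (fun q => u q - δ * q.1) (fderiv ℝ u q - δ • .fst ℝ ℝ E) q := fun q hq =>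
      (hd q hq).hasFDerivAt.sub (hasFDerivAt_fst.const_mul δ)
    refine nonpos_of_fderiv_lt hC (fun q hq => (hfderiv q hq).differentiableAt)
      (fun x hx => by simpa using h₀ x hx) (fun q hq => ?_) q hq
    have hinr : (fderiv ℝ u q - δ • .fst ℝ ℝ E).comp (.inr ℝ ℝ E)
        = (fderiv ℝ u q).comp (.inr ℝ ℝ E) := by
      ext v
      simp
    rw [(hfderiv q hq).fderiv, hinr]
    exact lt_of_lt_of_le (by simpa using hδ) (hle q hq)
  have hlim : Tendsto (fun δ : ℝ => u q - δ * q.1) (𝓝[>] 0) (𝓝 (u q)) := by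
    have h : Continuous fun δ : ℝ => u q - δ * q.1 := by fun_prop
    simpa using (h.tendsto 0).mono_left nhdsWithin_le_nhds
  exact le_of_tendsto hlim (eventually_mem_nhdsWithin.mono hperturbed)

theorem eq_zero_of_abs_fderiv_le (hC : 0 < C)
    (hd : ∀ q ∈ dependenceCone x₀ C R, DifferentiableAt ℝ u q)
    (h₀ : ∀ x ∈ closedBall x₀ R, u (0, x) = 0)
    (hle : ∀ q ∈ dependenceCone x₀ C R,
      |fderiv ℝ u q (1, 0)| ≤ C * ‖(fderiv ℝ u q).comp (.inr ℝ ℝ E)‖) :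
    ∀ q ∈ dependenceCone x₀ C R, u q = 0 := fun q hq => by
  have hneg := nonpos_of_fderiv_le (u := fun q => -u q) hC (fun q hq => (hd q hq).fun_neg)
    (fun x hx => by simp [h₀ x hx])
    (fun q hq => by
      rw [fderiv_fun_neg, ContinuousLinearMap.neg_comp, norm_neg]
      exact (neg_le_abs _).trans (hle q hq)) q hq
  exact le_antisymm (nonpos_of_fderiv_le hC hd (fun x hx => (h₀ x hx).le)
    (fun q hq => (le_abs_self _).trans (hle q hq)) q hq) (neg_nonpos.1 hneg)

theorem eventually_eq_zero_of_abs_fderiv_le_right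
    (hd : ∀ᶠ q in 𝓝 (0, x₀), DifferentiableAt ℝ u q) (h₀ : ∀ᶠ x in 𝓝 x₀, u (0, x) = 0)
    (hle : ∀ᶠ q in 𝓝 (0, x₀), |fderiv ℝ u q (1, 0)| ≤ C * ‖(fderiv ℝ u q).comp (.inr ℝ ℝ E)‖) :
    ∀ᶠ q in 𝓝 (0, x₀), 0 ≤ q.1 → u q = 0 := by
  have hC : 0 < |C| + 1 := by positivity
  obtain ⟨R, ⟨hcone, hball⟩, hR⟩ := ((eventually_dependenceCone_subset (hd.and hle) hC).and
    ((eventually_closedBall_subset h₀).filter_mono nhdsWithin_le_nhds) |>.and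
      eventually_mem_nhdsWithin).exists
  have hmem : ∀ᶠ q : ℝ × E in 𝓝 (0, x₀), (|C| + 1) * q.1 + dist q.2 x₀ < R :=
    ContinuousAt.eventually_lt (by fun_prop) continuousAt_const (by simpa using hR)
  filter_upwards [hmem] with q hq hq₀
  refine eq_zero_of_abs_fderiv_le hC (fun q hq => (hcone hq).1) (fun x hx => hball hx)
    (fun q hq => (hcone hq).2.trans ?_) q ⟨hq₀, hq.le⟩
  gcongr
  linarith [le_abs_self C]

theorem eventually_eq_zero_of_abs_fderiv_le
    (hd : ∀ᶠ q in 𝓝 (0, x₀), DifferentiableAt ℝ u q) (h₀ : ∀ᶠ x in 𝓝 x₀, u (0, x) = 0)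
    (hle : ∀ᶠ q in 𝓝 (0, x₀), |fderiv ℝ u q (1, 0)| ≤ C * ‖(fderiv ℝ u q).comp (.inr ℝ ℝ E)‖) :
    ∀ᶠ q in 𝓝 (0, x₀), u q = 0 := by
  have hreflect := tendsto_timeReflect x₀
  have hfderiv : ∀ᶠ q in 𝓝 (0, x₀), HasFDerivAt (u ∘ timeReflect)
      ((fderiv ℝ u (timeReflect q)).comp timeReflect) q :=
    (hreflect.eventually hd).mono fun q hq =>
      hq.hasFDerivAt.comp q (timeReflect (E := E)).hasFDerivAt
  have hle_past : ∀ᶠ q in 𝓝 (0, x₀), |fderiv ℝ (u ∘ timeReflect) q (1, 0)|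
      ≤ C * ‖(fderiv ℝ (u ∘ timeReflect) q).comp (.inr ℝ ℝ E)‖ := by
    filter_upwards [hfderiv, hreflect.eventually hle] with q hq hle
    have htime : (fderiv ℝ u (timeReflect q)).comp timeReflect (1, 0)
        = -fderiv ℝ u (timeReflect q) (1, 0) := by
      rw [← map_neg]
      simp [timeReflect_apply]
    have hspace : ((fderiv ℝ u (timeReflect q)).comp timeReflect).comp (.inr ℝ ℝ E)
        = (fderiv ℝ u (timeReflect q)).comp (.inr ℝ ℝ E) := by
      ext v
      simp [timeReflect_apply]
    rwa [hq.fderiv, htime, hspace, abs_neg]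
  have hfuture := eventually_eq_zero_of_abs_fderiv_le_right hd h₀ hle
  have hpast := eventually_eq_zero_of_abs_fderiv_le_right (u := u ∘ timeReflect)
    (hfderiv.mono fun q hq => hq.differentiableAt)
    (by simpa [timeReflect_apply] using h₀) hle_past
  filter_upwards [hfuture, hreflect.eventually hpast] with q hq hq_past
  rcases le_total 0 q.1 with h | h
  · exact hq h
  · simpa [timeReflect_apply] using hq_past (by simpa [timeReflect_apply] using h)

end Haar

/-! ### The Hamilton–Jacobi equation -/

section HamiltonJacobi

variable {n : ℕ} {U : Set (Pt n × Pt n)} {G : Pt n × Pt n → ℝ} {c : ℝ → ℝ}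
  {W : Set (ℝ × Pt n)} {S : ℝ → Pt n → ℝ} {q : ℝ × Pt n}

/-- The map `(h, x) ↦ (x, dS_h(x))`, which parametrizes the graphs of the differentials `dS_h`. -/
def lift (S : ℝ → Pt n → ℝ) (q : ℝ × Pt n) : Pt n × Pt n :=
  (q.2, differential (S q.1) q.2)

theorem contDiffAt_hamiltonianField {z : Pt n × Pt n} (hG : ContDiffAt ℝ 2 G z) :
    ContDiffAt ℝ 1 (hamiltonianField G) z := by
  have h : ContDiffAt ℝ 1 (fderiv ℝ G) z := hG.fderiv_right (by norm_num)
  exact (contDiffAt_pi.2 fun i => (h.clm_apply contDiffAt_const).neg).prodMk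
    (contDiffAt_pi.2 fun i => h.clm_apply contDiffAt_const)

namespace IsHJSolution

theorem contDiffAt (hS : IsHJSolution U G c W S) (hq : q ∈ W) :
    ContDiffAt ℝ ∞ (Function.uncurry S) q :=
  hS.smooth.contDiffAt (hS.isOpen.mem_nhds hq)

theorem hasFDerivAt (hS : IsHJSolution U G c W S) (hq : q ∈ W) :
    HasFDerivAt (Function.uncurry S) (fderiv ℝ (Function.uncurry S) q) q :=
  ((hS.contDiffAt hq).differentiableAt (by simp)).hasFDerivAt

theorem contDiffAt_fderiv (hS : IsHJSolution U G c W S) (hq : q ∈ W) :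
    ContDiffAt ℝ ∞ (fderiv ℝ (Function.uncurry S)) q :=
  (hS.contDiffAt hq).fderiv_right (by simp)

theorem hasFDerivAt_fderiv (hS : IsHJSolution U G c W S) (hq : q ∈ W) :
    HasFDerivAt (fderiv ℝ (Function.uncurry S))
      (fderiv ℝ (fderiv ℝ (Function.uncurry S)) q) q :=
  ((hS.contDiffAt_fderiv hq).differentiableAt (by simp)).hasFDerivAt

theorem lift_mem (hS : IsHJSolution U G c W S) (hq : q ∈ W) : lift S q ∈ U :=
  hS.mem q.1 q.2 hq

theorem lift_zero (hS : IsHJSolution U G c W S) (x : Pt n) : lift S (0, x) = (x, 0) := by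
  have h : S 0 = fun _ => 0 := funext hS.initial
  ext i
  · rfl
  · simp [lift, differential, pderiv, h]

theorem lift_snd_dotProduct (hS : IsHJSolution U G c W S) (hq : q ∈ W) (v : Pt n) :
    (lift S q).2 ⬝ᵥ v = fderiv ℝ (Function.uncurry S) q (0, v) := by
  have h : HasFDerivAt (S q.1) ((fderiv ℝ (Function.uncurry S) q).comp (.inr ℝ ℝ (Pt n))) q.2 :=
    HasFDerivAt.comp (g := Function.uncurry S) (f := fun x => (q.1, x)) q.2
      (hS.hasFDerivAt hq) (hasFDerivAt_prodMk_right q.1 q.2)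
  rw [lift, differential_dotProduct, h.fderiv]
  rfl

theorem fderiv_time (hS : IsHJSolution U G c W S) (hq : q ∈ W) :
    fderiv ℝ (Function.uncurry S) q (1, 0) = G (lift S q) + c q.1 := by
  have hline : HasDerivAt (fun t : ℝ => (t, q.2)) ((1, 0) : ℝ × Pt n) q.1 :=
    (hasDerivAt_id q.1).prodMk (hasDerivAt_const q.1 q.2)
  exact ((hS.hasFDerivAt hq).comp_hasDerivAt_of_eq q.1 hline rfl).unique (hS.eqn q.1 q.2 hq)

theorem contDiffAt_lift (hS : IsHJSolution U G c W S) (hq : q ∈ W) :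
    ContDiffAt ℝ ∞ (lift S) q := by
  have hsmooth : ContDiffAt ℝ ∞
      (fun q => (q.2, fun i => fderiv ℝ (Function.uncurry S) q (0, Pi.single i 1))) q :=
    contDiffAt_snd.prodMk <| contDiffAt_pi.2 fun i =>
      (hS.contDiffAt_fderiv hq).clm_apply contDiffAt_const
  refine hsmooth.congr_of_eventuallyEq ?_
  filter_upwards [hS.isOpen.mem_nhds hq] with w hw
  ext i
  · rfl
  · simpa using hS.lift_snd_dotProduct hw (Pi.single i 1)

theorem hasFDerivAt_lift (hS : IsHJSolution U G c W S) (hq : q ∈ W) :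
    HasFDerivAt (lift S) (fderiv ℝ (lift S) q) q :=
  ((hS.contDiffAt_lift hq).differentiableAt (by simp)).hasFDerivAt

theorem fst_fderiv_lift (hS : IsHJSolution U G c W S) (hq : q ∈ W) (k : ℝ × Pt n) :
    (fderiv ℝ (lift S) q k).1 = k.2 :=
  congrArg (· k) ((hS.hasFDerivAt_lift hq).fst.unique hasFDerivAt_snd)

theorem snd_fderiv_lift_dotProduct (hS : IsHJSolution U G c W S) (hq : q ∈ W) (k : ℝ × Pt n)
    (v : Pt n) :
    (fderiv ℝ (lift S) q k).2 ⬝ᵥ v = fderiv ℝ (fderiv ℝ (Function.uncurry S)) q k (0, v) := by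
  have hpair : HasFDerivAt (fun w => v ⬝ᵥ (lift S w).2) _ q :=
    (dotProductBilin (m := Fin n) ℝ ℝ v).toContinuousLinearMap.hasFDerivAt.comp q
      (hS.hasFDerivAt_lift hq).snd
  have heq : (fun w => v ⬝ᵥ (lift S w).2) =ᶠ[𝓝 q]
      fun w => fderiv ℝ (Function.uncurry S) w (0, v) := by
    filter_upwards [hS.isOpen.mem_nhds hq] with w hw
    rw [dotProduct_comm, hS.lift_snd_dotProduct hw]
  have happly : HasFDerivAt (fun w => fderiv ℝ (Function.uncurry S) w (0, v)) _ q :=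
    (hS.hasFDerivAt_fderiv hq).clm_apply (hasFDerivAt_const (0, v) q)
  have h := congrArg (· k) (hpair.unique (happly.congr_of_eventuallyEq heq))
  rw [dotProduct_comm]
  simpa using h

-- `c` need not be differentiable, so the equation is differentiated along lines in `x` only
theorem fderiv_fderiv_time (hS : IsHJSolution U G c W S) (hq : q ∈ W)
    (hG : DifferentiableAt ℝ G (lift S q)) (v : Pt n) :
    fderiv ℝ (fderiv ℝ (Function.uncurry S)) q (0, v) (1, 0)
      = fderiv ℝ G (lift S q) (fderiv ℝ (lift S) q (0, v)) := by
  have hline := hasDerivAt_line q (0, v)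
  have hlhs := ((hS.hasFDerivAt_fderiv hq).comp_hasDerivAt_of_eq (0 : ℝ) hline
    (by simp)).clm_apply (hasDerivAt_const (0 : ℝ) ((1, 0) : ℝ × Pt n))
  have hlift := (hS.hasFDerivAt_lift hq).comp_hasDerivAt_of_eq (0 : ℝ) hline (by simp)
  have hrhs := (hG.hasFDerivAt.comp_hasDerivAt_of_eq (0 : ℝ) hlift
    (by simp [-Prod.smul_mk])).add_const (c q.1)
  have hW : ∀ᶠ τ in 𝓝 (0 : ℝ), q + τ • ((0, v) : ℝ × Pt n) ∈ W :=
    hline.continuousAt.eventually (by simpa using hS.isOpen.mem_nhds hq)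
  have h := hlhs.unique <| hrhs.congr_of_eventuallyEq <| hW.mono fun τ hτ => by
    simpa using hS.fderiv_time hτ
  simpa using h

theorem fderiv_lift_hamiltonianField (hS : IsHJSolution U G c W S) (hq : q ∈ W)
    (hG : DifferentiableAt ℝ G (lift S q)) :
    fderiv ℝ (lift S) q (1, (hamiltonianField G (lift S q)).1)
      = hamiltonianField G (lift S q) := by
  set X := hamiltonianField G (lift S q) with hX
  refine Prod.ext (hS.fst_fderiv_lift hq _) (dotProduct_eq _ _ fun v => ?_)
  set Y := fderiv ℝ (lift S) q (0, v)
  set D := fderiv ℝ (fderiv ℝ (Function.uncurry S)) q with hD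
  have hsymm (a b : ℝ × Pt n) : D a b = D b a :=
    (contDiffAt_infty.1 (hS.contDiffAt hq) 2).isSymmSndFDerivAt (by simp) a b
  have hsplit : ((1, X.1) : ℝ × Pt n) = (1, 0) + (0, X.1) := by simp
  calc (fderiv ℝ (lift S) q (1, X.1)).2 ⬝ᵥ v = D (0, v) (1, X.1) := by
        rw [hS.snd_fderiv_lift_dotProduct hq, ← hD, hsymm]
    _ = fderiv ℝ G (lift S q) Y + Y.2 ⬝ᵥ X.1 := by
        rw [hsplit, map_add, hS.fderiv_fderiv_time hq hG, hS.snd_fderiv_lift_dotProduct hq]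
    _ = X.2 ⬝ᵥ Y.1 := by
        rw [← hamiltonianField_pairing, ← hX, dotProduct_comm X.1, sub_add_cancel]
    _ = X.2 ⬝ᵥ v := by rw [hS.fst_fderiv_lift hq]

theorem hasDerivWithinAt_lift_sub (hS : IsHJSolution U G c W S) {γ : ℝ → Pt n × Pt n} {s : Set ℝ}
    {t : ℝ} (hW : (t, (γ t).1) ∈ W) (hG : DifferentiableAt ℝ G (lift S (t, (γ t).1)))
    (hγ : HasDerivWithinAt γ (hamiltonianField G (γ t)) s t) :
    HasDerivWithinAt (fun t => lift S (t, (γ t).1) - γ t)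
      (hamiltonianField G (lift S (t, (γ t).1)) - hamiltonianField G (γ t)
        + fderiv ℝ (lift S) (t, (γ t).1)
          (0, (hamiltonianField G (γ t) - hamiltonianField G (lift S (t, (γ t).1))).1)) s t := by
  set X := hamiltonianField G
  set z := lift S (t, (γ t).1)
  have hbase : HasDerivWithinAt (fun t => (t, (γ t).1)) (1, (X (γ t)).1) s t :=
    (hasDerivWithinAt_id t s).prodMk ((hasFDerivAt_fst (p := γ t)).comp_hasDerivWithinAt t hγ)
  have hsplit : ((1, (X (γ t)).1) : ℝ × Pt n) = (1, (X z).1) + (0, (X (γ t) - X z).1) := by simp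
  refine (((hS.hasFDerivAt_lift hW).comp_hasDerivWithinAt t hbase).fun_sub hγ).congr_deriv ?_
  rw [hsplit, map_add, hS.fderiv_lift_hamiltonianField hW hG]
  abel

theorem exists_eventually_norm_hamiltonianField_sub_add_le (hS : IsHJSolution U G c W S)
    (hq : q ∈ W) (hG : ContDiffAt ℝ 2 G (lift S q)) :
    ∃ K : ℝ, ∀ᶠ p in 𝓝 (q, lift S q),
      ‖hamiltonianField G (lift S p.1) - hamiltonianField G p.2
        + fderiv ℝ (lift S) p.1
          (0, (hamiltonianField G p.2 - hamiltonianField G (lift S p.1)).1)‖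
        ≤ K * ‖lift S p.1 - p.2‖ := by
  set X := hamiltonianField G
  obtain ⟨K, V, hV, hK⟩ := (contDiffAt_hamiltonianField hG).exists_lipschitzOnWith
  have hfderiv : ContinuousAt (fun q => ‖fderiv ℝ (lift S) q‖) q :=
    ((hS.contDiffAt_lift hq).fderiv_right (m := ∞) (by simp)).continuousAt.norm
  obtain ⟨N, hN⟩ : ∃ N, ∀ᶠ q in 𝓝 q, ‖fderiv ℝ (lift S) q‖ < N :=
    ⟨_, hfderiv.eventually_lt continuousAt_const (lt_add_one _)⟩
  have hlift := (hS.contDiffAt_lift hq).continuousAt.eventually_mem hV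
  refine ⟨(1 + N) * K, ?_⟩
  filter_upwards [(hN.and hlift).prod_inl_nhds _, Eventually.prod_inr_nhds hV _]
    with ⟨q, z⟩ ⟨hN, hqV⟩ hzV
  have hN₀ : 0 ≤ N := (norm_nonneg _).trans hN.le
  have hfst : ‖((0, (X z - X (lift S q)).1) : ℝ × Pt n)‖ ≤ ‖X (lift S q) - X z‖ := by
    rw [norm_sub_rev, Prod.norm_mk, norm_zero, max_eq_right (norm_nonneg _)]
    exact norm_fst_le _
  calc ‖X (lift S q) - X z + fderiv ℝ (lift S) q (0, (X z - X (lift S q)).1)‖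
      ≤ ‖X (lift S q) - X z‖ + N * ‖X (lift S q) - X z‖ :=
        norm_add_le_of_le le_rfl (ContinuousLinearMap.le_of_opNorm_le_of_le _ hN.le hfst)
    _ = (1 + N) * ‖X (lift S q) - X z‖ := by ring
    _ ≤ (1 + N) * (K * ‖lift S q - z‖) := by
        gcongr
        exact hK.norm_sub_le hqV hzV
    _ = (1 + N) * K * ‖lift S q - z‖ := by ring

-- the method of characteristics
theorem lift_eq_of_isIntegralCurveOn (hS : IsHJSolution U G c W S)
    (hG : ∀ z ∈ U, ContDiffAt ℝ 2 G z) {γ : ℝ → Pt n × Pt n} {h : ℝ} (h₀ : (γ 0).2 = 0)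
    (hγ : IsIntegralCurveOn γ (fun _ => hamiltonianField G) (Icc 0 h))
    (hγW : ∀ t ∈ Icc 0 h, (t, (γ t).1) ∈ W) {t : ℝ} (ht : t ∈ Icc 0 h) :
    lift S (t, (γ t).1) = γ t := by
  refine sub_eq_zero.1 (eqOn_zero_of_eventually_norm_deriv_le (fun t ht =>
    hS.hasDerivWithinAt_lift_sub (hγW t ht)
      ((hG _ (hS.lift_mem (hγW t ht))).differentiableAt (by simp)) (hγ t ht)) ?_
    (fun t ht hzero => ?_) ht)
  · rw [hS.lift_zero, sub_eq_zero]
    exact Prod.ext rfl h₀.symm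
  have htW := hγW t (Ico_subset_Icc_self ht)
  have hγt := hγ.continuousOn t (Ico_subset_Icc_self ht)
  obtain ⟨K, hK⟩ :=
    hS.exists_eventually_norm_hamiltonianField_sub_add_le htW (hG _ (hS.lift_mem htW))
  rw [sub_eq_zero.1 hzero] at hK
  have hpair : Tendsto (fun s => ((s, (γ s).1), γ s)) (𝓝[Icc 0 h] t) (𝓝 ((t, (γ t).1), γ t)) :=
    (continuousWithinAt_id.prodMk hγt.fst).prodMk hγt
  exact ⟨K, hpair.eventually hK⟩

end IsHJSolution

end HamiltonJacobi

/-! ### Oddness of the generating function -/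

section Oddness

variable {n : ℕ} {U D : Set (Pt n × Pt n)} {G : Pt n × Pt n → ℝ} {c : ℝ → ℝ}
  {W W' : Set (ℝ × Pt n)} {S T : ℝ → Pt n → ℝ}

theorem reflectionDefect_zeroSection (G : Pt n × Pt n → ℝ) (x : Pt n) :
    reflectionDefect G (x, 0) = 0 := by
  simp [reflectionDefect, reflect]

theorem differentiableAt_reflectionDefect {z : Pt n × Pt n} (hG : DifferentiableAt ℝ G z)
    (hG' : DifferentiableAt ℝ G (reflect z)) : DifferentiableAt ℝ (reflectionDefect G) z :=
  hG.fun_sub (hG'.comp z (contDiff_reflect.contDiffAt.differentiableAt (by simp)))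

namespace IsCommutationDomain

theorem mapsTo (hD : IsCommutationDomain U G D) {X : Type*} [TopologicalSpace X]
    {γ : X → Pt n × Pt n} {s : Set X} (hs : IsPreconnected s) (hγ : ContinuousOn γ s)
    (hU : MapsTo γ s U) {t : X} (ht : t ∈ s) (htD : γ t ∈ D) : MapsTo γ s D := by
  refine mapsTo_iff_image_subset.2 <| (hs.image γ hγ).subset_of_closure_inter_subset hD.isOpen
    ⟨γ t, mem_image_of_mem γ ht, htD⟩ ?_
  rintro _ ⟨hcl, r, hr, rfl⟩
  exact hD.mem_of_mem_closure _ (hU hr) hcl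

theorem reflectionDefect_eq_zero (hD : IsCommutationDomain U G D)
    (hG : ∀ z ∈ U, DifferentiableAt ℝ (reflectionDefect G) z) {h : ℝ} {z : Pt n × Pt n}
    (hz : z ∈ flowOfZeroSection U G h) : reflectionDefect G z = 0 := by
  obtain ⟨γ, h₀, hU, hγ, rfl⟩ := hz
  have hstart : γ 0 = ((γ 0).1, 0) := Prod.ext rfl h₀
  have hmaps : MapsTo γ (uIcc 0 h) D :=
    hD.mapsTo isPreconnected_uIcc hγ.continuousOn hU left_mem_uIcc (hstart ▸ hD.zero_mem _)
  have hderiv : ∀ t ∈ uIcc 0 h,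
      HasDerivWithinAt (reflectionDefect G ∘ γ) 0 (uIcc 0 h) t := fun t ht =>
    ((hG _ (hU t ht)).hasFDerivAt.comp_hasDerivWithinAt t (hγ t ht)).congr_deriv
      (hD.fderiv_reflectionDefect _ (hmaps ht))
  have hconst := (convex_uIcc 0 h).norm_image_sub_le_of_norm_hasDerivWithin_le (C := 0) hderiv
    (fun _ _ => norm_zero.le) left_mem_uIcc right_mem_uIcc
  rwa [zero_mul, norm_le_zero_iff, Function.comp_apply, Function.comp_apply, hstart,
    reflectionDefect_zeroSection, sub_zero] at hconst

end IsCommutationDomain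

theorem norm_le_opNorm_of_forall_dotProduct_eq {v : Pt n} {L : Pt n →L[ℝ] ℝ}
    (h : ∀ w, v ⬝ᵥ w = L w) : ‖v‖ ≤ ‖L‖ := by
  refine (pi_norm_le_iff_of_nonneg (norm_nonneg L)).2 fun i => ?_
  have hi : v i = L (Pi.single i 1) := by simpa using h (Pi.single i 1)
  simpa [hi, Pi.norm_single] using L.le_opNorm (Pi.single i 1)

theorem lift_neg_comp_neg (S : ℝ → Pt n → ℝ) (q : ℝ × Pt n) :
    lift (fun t x => -S (-t) x) q = reflect (lift S (timeReflect q)) := by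
  ext i
  · rfl
  · simp [lift, reflect, timeReflect_apply, differential, pderiv, fderiv_fun_neg]

namespace IsHJSolution

theorem mono (hS : IsHJSolution U G c W S) (hW' : IsOpen W') (hzero : ∀ x, (0, x) ∈ W')
    (hsub : W' ⊆ W) : IsHJSolution U G c W' S where
  isOpen := hW'
  zero_mem := hzero
  smooth := hS.smooth.mono hsub
  initial := hS.initial
  mem h x hq := hS.mem h x (hsub hq)
  eqn h x hq := hS.eqn h x (hsub hq)

theorem neg_comp_neg (hS : IsHJSolution U G c W S) (hc : ∀ h, c (-h) = c h)
    (hU : ∀ z ∈ U, reflect z ∈ U) (hdefect : ∀ q ∈ W, reflectionDefect G (lift S q) = 0) :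
    IsHJSolution U G c (timeReflect ⁻¹' W) fun t x => -S (-t) x where
  isOpen := hS.isOpen.preimage timeReflect.continuous
  zero_mem x := by simpa [timeReflect_apply] using hS.zero_mem x
  smooth := (hS.smooth.comp timeReflect.contDiff.contDiffOn (mapsTo_preimage _ _)).neg
  initial x := by simp [hS.initial]
  mem h x hq := by
    have hmem : reflect (lift S (timeReflect (h, x))) ∈ U := hU _ (hS.lift_mem hq)
    rwa [← lift_neg_comp_neg] at hmem
  eqn h x hq := by
    refine ((hS.eqn (-h) x hq).scomp h (hasDerivAt_neg h)).fun_neg.congr_deriv ?_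
    have hreverse : G (lift (fun t x => -S (-t) x) (h, x)) = G (lift S (-h, x)) := by
      rw [lift_neg_comp_neg, ← sub_eq_zero, ← neg_sub, neg_eq_zero]
      exact hdefect _ hq
    rw [neg_smul, one_smul, neg_neg, hc]
    exact congrArg (· + c h) hreverse.symm

theorem eventually_reflectionDefect_lift_eq_zero (hS : IsHJSolution U G c W S)
    (hG : ∀ z ∈ U, ContDiffAt ℝ 2 G z)
    (hG' : ∀ z ∈ U, DifferentiableAt ℝ (reflectionDefect G) z)
    (hD : IsCommutationDomain U G D) (x : Pt n) :
    ∀ᶠ q in 𝓝 (0, x), reflectionDefect G (lift S q) = 0 := by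
  have hW : ∀ᶠ q in 𝓝 (0, x), q ∈ W := hS.isOpen.mem_nhds (hS.zero_mem x)
  have hlift := (hS.contDiffAt_lift (hS.zero_mem x)).continuousAt
  have hliftD : ∀ᶠ q in 𝓝 (0, x), lift S q ∈ D :=
    hlift.eventually_mem (hD.isOpen.mem_nhds (hS.lift_zero x ▸ hD.zero_mem x))
  have hfield : ContinuousAt (fun q => ‖(hamiltonianField G (lift S q)).1‖) (0, x) :=
    ((contDiffAt_hamiltonianField (hG _ (hS.lift_mem (hS.zero_mem x)))).continuousAt.comp
      hlift).fst.norm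
  obtain ⟨C, hC⟩ : ∃ C, ∀ᶠ q in 𝓝 (0, x), ‖(hamiltonianField G (lift S q)).1‖ < C :=
    ⟨_, hfield.eventually_lt continuousAt_const (lt_add_one _)⟩
  have hfderiv : ∀ q ∈ W, HasFDerivAt (fun q => reflectionDefect G (lift S q))
      ((fderiv ℝ (reflectionDefect G) (lift S q)).comp (fderiv ℝ (lift S) q)) q := fun q hq =>
    (hG' _ (hS.lift_mem hq)).hasFDerivAt.comp q (hS.hasFDerivAt_lift hq)
  refine eventually_eq_zero_of_abs_fderiv_le (C := C)
    (hW.mono fun q hq => (hfderiv q hq).differentiableAt)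
    (.of_forall fun y => by rw [hS.lift_zero, reflectionDefect_zeroSection]) ?_
  filter_upwards [hW, hliftD, hC] with q hq hqD hqC
  set X := hamiltonianField G (lift S q) with hX
  set L := fderiv ℝ (fun q => reflectionDefect G (lift S q)) q with hL
  have hconserved : L (1, X.1) = 0 := by
    rw [hL, (hfderiv q hq).fderiv, ContinuousLinearMap.comp_apply, hX,
      hS.fderiv_lift_hamiltonianField hq ((hG _ (hS.lift_mem hq)).differentiableAt (by simp))]
    exact hD.fderiv_reflectionDefect _ hqD
  have htime : L (1, 0) = -L.comp (.inr ℝ ℝ (Pt n)) X.1 := by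
    rw [← add_eq_zero_iff_eq_neg, ← hconserved, ContinuousLinearMap.comp_apply, ← map_add]
    simp
  rw [htime, abs_neg, mul_comm]
  exact (L.comp (.inr ℝ ℝ (Pt n))).le_opNorm_of_le hqC.le

theorem eventually_eq (hS : IsHJSolution U G c W S) (hT : IsHJSolution U G c W' T) {x : Pt n}
    (hG : ContDiffAt ℝ 1 G (x, 0)) : ∀ᶠ q in 𝓝 (0, x), S q.1 q.2 = T q.1 q.2 := by
  have hW : ∀ᶠ q in 𝓝 (0, x), q ∈ W := hS.isOpen.mem_nhds (hS.zero_mem x)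
  have hW' : ∀ᶠ q in 𝓝 (0, x), q ∈ W' := hT.isOpen.mem_nhds (hT.zero_mem x)
  obtain ⟨K, V, hV, hK⟩ := hG.exists_lipschitzOnWith
  have hSV := (hS.contDiffAt_lift (hS.zero_mem x)).continuousAt.eventually_mem
    (hS.lift_zero x ▸ hV)
  have hTV := (hT.contDiffAt_lift (hT.zero_mem x)).continuousAt.eventually_mem
    (hT.lift_zero x ▸ hV)
  have hfderiv (q : ℝ × Pt n) (hq : q ∈ W) (hq' : q ∈ W') :=
    (hS.hasFDerivAt hq).sub (hT.hasFDerivAt hq')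
  suffices h : ∀ᶠ q in 𝓝 (0, x), (Function.uncurry S - Function.uncurry T) q = 0 from
    h.mono fun q hq => sub_eq_zero.1 hq
  refine eventually_eq_zero_of_abs_fderiv_le (C := K)
    ((hW.and hW').mono fun q hq => (hfderiv q hq.1 hq.2).differentiableAt)
    (.of_forall fun y => by simp [hS.initial, hT.initial]) ?_
  filter_upwards [hW, hW', hSV, hTV] with q hq hq' hqV hqV'
  rw [(hfderiv q hq hq').fderiv, _root_.sub_apply, hS.fderiv_time hq, hT.fderiv_time hq',
    add_sub_add_right_eq_sub, ← Real.norm_eq_abs]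
  refine (hK.norm_sub_le hqV hqV').trans (mul_le_mul_of_nonneg_left ?_ K.2)
  have hsub : lift S q - lift T q = (0, (lift S q).2 - (lift T q).2) := Prod.ext (sub_self q.2) rfl
  rw [hsub, Prod.norm_mk, norm_zero, max_eq_right (norm_nonneg _)]
  refine norm_le_opNorm_of_forall_dotProduct_eq fun v => ?_
  rw [sub_dotProduct, hS.lift_snd_dotProduct hq, hT.lift_snd_dotProduct hq']
  rfl

theorem eventually_odd (hS : IsHJSolution U G c W S) (hc : ∀ h, c (-h) = c h)
    (hU : ∀ z ∈ U, reflect z ∈ U) (hG : ∀ z ∈ U, ContDiffAt ℝ 2 G z)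
    (hD : IsCommutationDomain U G D) (x : Pt n) :
    ∀ᶠ q in 𝓝 (0, x), S (-q.1) q.2 = -S q.1 q.2 := by
  have hdefect : ∀ z ∈ U, DifferentiableAt ℝ (reflectionDefect G) z := fun z hz =>
    differentiableAt_reflectionDefect ((hG z hz).differentiableAt (by simp))
      ((hG _ (hU z hz)).differentiableAt (by simp))
  let W₀ := interior {q | q ∈ W ∧ reflectionDefect G (lift S q) = 0}
  have hzero (y : Pt n) : (0, y) ∈ W₀ := mem_interior_iff_mem_nhds.2 <|
    (hS.isOpen.eventually_mem (hS.zero_mem y)).and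
      (hS.eventually_reflectionDefect_lift_eq_zero hG hdefect hD y)
  have hS₀ := hS.mono isOpen_interior hzero fun q hq => (interior_subset hq).1
  have hT := hS₀.neg_comp_neg hc hU fun q hq => (interior_subset hq).2
  have hG₀ : ContDiffAt ℝ 2 G (x, 0) := hS.lift_zero x ▸ hG _ (hS.lift_mem (hS.zero_mem x))
  filter_upwards [hS.eventually_eq hT (hG₀.of_le (by norm_num))] with q hq
  rw [hq, neg_neg]

theorem eq_of_lift_mem_flowOfZeroSection (hS : IsHJSolution U G c W S)
    (hT : IsHJSolution U G c W' T) (hG : ∀ z ∈ U, ContDiffAt ℝ 2 G z) {h : ℝ} (hh : 0 ≤ h)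
    (hW : Icc 0 h ×ˢ univ ⊆ W) (hW' : Icc 0 h ×ˢ univ ⊆ W')
    (hflow : ∀ t ∈ Icc 0 h, ∀ x, lift S (t, x) ∈ flowOfZeroSection U G t) (x : Pt n) :
    S h x = T h x := by
  have hlift : ∀ t ∈ Icc 0 h, lift S (t, x) = lift T (t, x) := fun t ht => by
    obtain ⟨γ, h₀, -, hγ, hγt⟩ := hflow t ht x
    rw [uIcc_of_le ht.1] at hγ
    have hT_lift := hT.lift_eq_of_isIntegralCurveOn hG h₀ hγ
      (fun s hs => hW' ⟨⟨hs.1, hs.2.trans ht.2⟩, mem_univ _⟩) (right_mem_Icc.2 ht.1)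
    rw [hγt] at hT_lift
    exact hT_lift.symm
  have hderiv : ∀ t ∈ Icc 0 h, HasDerivWithinAt (fun t => S t x - T t x) 0 (Icc 0 h) t :=
    fun t ht => by
      refine (((hS.eqn t x (hW ⟨ht, mem_univ x⟩)).fun_sub
        (hT.eqn t x (hW' ⟨ht, mem_univ x⟩))).congr_deriv ?_).hasDerivWithinAt
      rw [add_sub_add_right_eq_sub, sub_eq_zero]
      exact congrArg G (hlift t ht)
  have hconst := (convex_Icc 0 h).norm_image_sub_le_of_norm_hasDerivWithin_le (C := 0) hderiv
    (fun _ _ => norm_zero.le) (left_mem_Icc.2 hh) (right_mem_Icc.2 hh)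
  rwa [zero_mul, norm_le_zero_iff, hS.initial, hT.initial, sub_zero, sub_zero, sub_eq_zero]
    at hconst

theorem odd_of_graphDifferential_eq (hS : IsHJSolution U G c W S) (hc : ∀ h, c (-h) = c h)
    (hU : ∀ z ∈ U, reflect z ∈ U) (hG : ∀ z ∈ U, ContDiffAt ℝ 2 G z)
    (hD : IsCommutationDomain U G D) {r : ℝ} (hW : Ioo (-r) r ×ˢ univ ⊆ W)
    (hflow : ∀ h ∈ Ioo (-r) r, graphDifferential (S h) = flowOfZeroSection U G h) {h : ℝ}
    (hh : h ∈ Ioo (-r) r) (x : Pt n) : S (-h) x = -S h x := by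
  have hlift (t : ℝ) (ht : t ∈ Ioo (-r) r) (y : Pt n) :
      lift S (t, y) ∈ flowOfZeroSection U G t := hflow t ht ▸ rfl
  have hdefect : ∀ z ∈ U, DifferentiableAt ℝ (reflectionDefect G) z := fun z hz =>
    differentiableAt_reflectionDefect ((hG z hz).differentiableAt (by simp))
      ((hG _ (hU z hz)).differentiableAt (by simp))
  have hr : 0 < r := by linarith [hh.1, hh.2]
  have hT := (hS.mono (isOpen_Ioo.prod isOpen_univ)
    (fun y => ⟨⟨neg_lt_zero.2 hr, hr⟩, mem_univ y⟩) hW).neg_comp_neg hc hU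
    fun q hq => hD.reflectionDefect_eq_zero hdefect (hlift q.1 hq.1 q.2)
  have hodd : ∀ t ∈ Ico 0 r, S (-t) x = -S t x := fun t ht => by
    have hsub : Icc 0 t ⊆ Ioo (-r) r := fun s hs =>
      ⟨(neg_lt_zero.2 hr).trans_le hs.1, hs.2.trans_lt ht.2⟩
    rw [hS.eq_of_lift_mem_flowOfZeroSection hT hG ht.1
      ((prod_mono_left hsub).trans hW)
      (fun q hq => ⟨neg_mem_Ioo_iff.2 (by simpa using hsub hq.1), mem_univ _⟩)
      (fun s hs => hlift s (hsub hs)) x, neg_neg]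
  rcases le_total 0 h with hpos | hneg
  · exact hodd h ⟨hpos, hh.2⟩
  · rw [← neg_eq_iff_eq_neg, ← hodd (-h) ⟨neg_nonneg.2 hneg, neg_lt.1 hh.1⟩, neg_neg]

end IsHJSolution

theorem coeff_eq_zero_of_even {x : Pt n} (h : ∀ᶠ t in 𝓝 (0 : ℝ), S (-t) x = -S t x) {l : ℕ}
    (hl : Even l) : coeff S l x = 0 := by
  have heq := EventuallyEq.iteratedDeriv_eq l h
  rw [iteratedDeriv_comp_neg l (fun t => S t x), iteratedDeriv_fun_neg, hl.neg_one_pow, one_smul,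
    neg_zero] at heq
  rw [coeff, self_eq_neg.1 heq, zero_div]

theorem truncation_eq_sum_odd {x : Pt n} (h : ∀ l, Even l → coeff S l x = 0) (m : ℕ) (t : ℝ) :
    truncation S m t x = ∑ l ∈ (Finset.range (m + 1)).filter Odd, coeff S l x * t ^ l := by
  refine (Finset.sum_filter_of_ne fun l _ hl => ?_).symm
  contrapose! hl
  rw [h l (Nat.not_odd_iff_even.1 hl), zero_mul]

theorem exists_isOpen_odd (hW : IsOpen W) (hzero : ∀ x, (0, x) ∈ W)
    (hodd : ∀ x, ∀ᶠ q in 𝓝 (0, x), S (-q.1) q.2 = -S q.1 q.2) :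
    ∃ W' ⊆ W, IsOpen W' ∧ (∀ x, (0, x) ∈ W') ∧
      ∀ h x, (h, x) ∈ W' → (-h, x) ∈ W' ∧ S (-h) x = -S h x := by
  let O := W ∩ interior {q | S (-q.1) q.2 = -S q.1 q.2}
  have hO : IsOpen O := hW.inter isOpen_interior
  have hOzero (x : Pt n) : (0, x) ∈ O := ⟨hzero x, mem_interior_iff_mem_nhds.2 (hodd x)⟩
  refine ⟨O ∩ timeReflect ⁻¹' O, fun q hq => hq.1.1, hO.inter (hO.preimage timeReflect.continuous),
    fun x => ⟨hOzero x, by simpa [timeReflect_apply] using hOzero x⟩,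
    fun h x hq => ⟨⟨hq.2, ?_⟩, ?_⟩⟩
  · simpa [timeReflect_apply] using hq.1
  · exact interior_subset (s := {q : ℝ × Pt n | S (-q.1) q.2 = -S q.1 q.2}) hq.1.2

end Oddness

end Karasev

end

theorem mainTheorem3 {n : ℕ} (π : Karasev.Pt n → Matrix (Fin n) (Fin n) ℝ)
    (hπ : Karasev.IsPoissonTensor π) (H : Karasev.Pt n → ℝ) (hH : ContDiff ℝ ∞ H)
    (ε : ℝ) (hε : 0 ≤ ε)
    (U : Set (Karasev.Pt n × Karasev.Pt n)) (α : Karasev.Pt n × Karasev.Pt n → Karasev.Pt n)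
    (hα : Karasev.IsKarasevMap π ε U α)
    (c : ℝ → ℝ) (hc : ∀ h, c (-h) = c h)
    (W : Set (ℝ × Karasev.Pt n)) (S : ℝ → Karasev.Pt n → ℝ)
    (hS : Karasev.IsHJSolution U (H ∘ α) c W S) :
    -- on any interval of times on which `S` is globally defined and generates the flow
    -- of the zero section, `S` is odd
    (∀ r : ℝ, Set.Ioo (-r) r ×ˢ Set.univ ⊆ W →
      (∀ h ∈ Set.Ioo (-r) r,
        Karasev.graphDifferential (S h) = Karasev.flowOfZeroSection U (H ∘ α) h) →
      ∀ h ∈ Set.Ioo (-r) r, ∀ x, S (-h) x = -S h x) ∧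
    -- with no assumption besides the evolution equation, `S` is odd near `h = 0`
    (∃ W' ⊆ W, IsOpen W' ∧ (∀ x, (0, x) ∈ W') ∧
      ∀ h x, (h, x) ∈ W' → (-h, x) ∈ W' ∧ S (-h) x = -S h x) ∧
    -- the truncations of `S` have only odd powers of `h`
    (∀ l x, Even l → Karasev.coeff S l x = 0) ∧
    (∀ m h x, Karasev.truncation S m h x =
      ∑ l ∈ (Finset.range (m + 1)).filter Odd, Karasev.coeff S l x * h ^ l) := by
  obtain ⟨D, hD⟩ := hα.exists_isCommutationDomain hπ hε (hH.differentiable (by simp))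
  have hU : ∀ z ∈ U, Karasev.reflect z ∈ U := fun z hz => hα.reflect_mem hz
  have hG : ∀ z ∈ U, ContDiffAt ℝ 2 (H ∘ α) z := fun z hz =>
    (hH.contDiffAt.comp z (hα.contDiffAt hz)).of_le (mod_cast ENat.LEInfty.out)
  have hodd := hS.eventually_odd hc hU hG hD
  have heven (l : ℕ) (x : Karasev.Pt n) (hl : Even l) : Karasev.coeff S l x = 0 := by
    have htime : Filter.Tendsto (fun t : ℝ => (t, x)) (𝓝 0) (𝓝 (0, x)) :=
      Continuous.tendsto' (by fun_prop) 0 (0, x) rfl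
    exact Karasev.coeff_eq_zero_of_even (htime.eventually (hodd x)) hl
  exact ⟨fun r hW hflow h hh x => hS.odd_of_graphDifferential_eq hc hU hG hD hW hflow hh x,
    Karasev.exists_isOpen_odd hS.isOpen hS.zero_mem hodd, heven,
    fun m h x => Karasev.truncation_eq_sum_odd (fun l => heven l x) m h⟩
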